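/- Let $E\to M$ be a smooth real vector bundle of finite rank over a smooth manifold $M$, and let $E$ and its dual $E^*$ both carry Lie algebroid structures, with brackets $[\cdot,\cdot]$ and $[\cdot,\cdot]_*$ and anchors $\rho$ and $\alpha_*$. Let $d_*:C^\infty(M)\to\Gamma(E)$ and $d_*:\Gamma(E)\to\Gamma(\wedge^2E)$ be the Lie algebroid coboundary operators of $E^*$, that is, $\langle d_*f,\xi\rangle=\alpha_*(\xi)f$ and $$(d_*u)(\xi,\eta)=\alpha_*(\xi)\langle u,\eta\rangle-\alpha_*(\eta)\langle u,\xi\rangle-\langle u,[\xi,\eta]_*\rangle .$$ The pair $(E,E^*)$ is a *Lie bialgebroid* if $d_*[u,v]=[d_*u,v]+[u,d_*v]$ for all $u,v\in\Gamma(E)$, where for $W\in\Gamma(\wedge^2E)$ the Schouten bracket $[u,W]=-[W,u]$ is the extension of $[u,\cdot]$ as a derivation of the wedge product. It is a *coboundary Lie bialgebroid* if moreover $d_*u=[\tau,u]$ for all $u\in\Gamma(E)$, for some $\tau\in\Gamma(\wedge^2E)$. Let $\mathfrak{D}E$ be the gauge Lie algebroid of $E$: its sections are the $\mathbb{R}$-linear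 operators $\delta$ on $\Gamma(E)$ with $\delta(fu)=f\,\delta u+\alpha(\delta)(f)\,u$ for a vector field $\alpha(\delta)$, the bracket is the commutator and the anchor is $\alpha$. Let $$\mathfrak{J}E=\{\nu\in\mathrm{Hom}(\mathfrak{D}E,E)\;:\;\nu(\Phi)=\Phi(\nu(1_E))\ \text{ for all }\Phi\in\mathfrak{gl}(E)\}$$ be the first jet bundle of $E$, with pairing $\langle\nu,\delta\rangle=\nu(\delta)\in E$. For $u\in\Gamma(E)$ and $f\in C^\infty(M)$ it has the sections $\mathbf{d}u:\delta\mapsto\delta u$ and $\mathrm{d}f\otimes u:\delta\mapsto\alpha(\delta)(f)\,u$. Let $\pi:\mathfrak{J}E\to\mathfrak{D}E$ be the adjoint representation of $E$, the bundle map with $\pi(\mathbf{d}u)(v)=[u,v]$, and let $$[\mu,\nu]_\pi=\mathfrak{L}_{\pi(\mu)}\nu-\mathfrak{L}_{\pi(\nu)}\mu-\mathbf{d}\langle\nu,\pi(\mu)\rangle,\qquad \langle\mathfrak{L}_\delta\mu,\delta'\rangle=\delta\langle\mu,\delta'\rangle-\langle\mu,[\delta,\delta']\rangle .$$ Then $(\mathfrak{J}E,[\cdot,\cdot]_\pi,\alpha\circ\pi)$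 is the jet Lie algebroid of $E$. Let $\widetilde\pi$ be its tensor representation on $\wedge^2E$ induced by $\pi$. A bundle map $\varphi:\mathfrak{J}E\to\wedge^2E$ is a *$1$-cocycle* if $\widetilde\pi(\mu)\varphi(\nu)-\widetilde\pi(\nu)\varphi(\mu)-\varphi([\mu,\nu]_\pi)=0$ for all $\mu,\nu\in\Gamma(\mathfrak{J}E)$, and a *coboundary* if there is $W\in\Gamma(\wedge^2E)$ with $\varphi(\mu)=\widetilde\pi(\mu)W$ for all $\mu\in\Gamma(\mathfrak{J}E)$. There is a unique bundle map $\hat d_*:\mathfrak{J}E\to\wedge^2E$ with $\hat d_*(\mathbf{d}u)=d_*u$ and $\hat d_*(\mathrm{d}f\otimes u)=d_*f\wedge u$ for all $u\in\Gamma(E)$, $f\in C^\infty(M)$, and: 1. $(E,E^*)$ is a Lie bialgebroid if and only if $\hat d_*$ is a $1$-cocycle. 2. The following are equivalent: $(E,E^*)$ is a coboundary Lie bialgebroid; there is $\tau\in\Gamma(\wedge^2E)$ with $d_*u=[\tau,u]$ for all $u\in\Gamma(E)$; $\hat d_*$ is a coboundary. -/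

import Mathlib

open Bundle
open scoped Manifold ContDiff

noncomputable section

section SmoothSections

variable {H : Type*} [NormedAddCommGroup H] [NormedSpace ℝ H]
  {M : Type*} [TopologicalSpace M] [ChartedSpace H M]
  {F : Type*} [NormedAddCommGroup F] [NormedSpace ℝ F]
  {E : M → Type*} [TopologicalSpace (TotalSpace F E)]
  [∀ x, AddCommGroup (E x)] [∀ x, Module ℝ (E x)] [∀ x, TopologicalSpace (E x)]
  [FiberBundle F E] [VectorBundle ℝ F E]

/-- Pointwise multiplication of a smooth section by a smooth function. -/
instance instSMulSection :
    SMul C^∞⟮𝓘(ℝ, H), M; ℝ⟯ Cₛ^∞⟮𝓘(ℝ, H); F, E⟯ :=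
  ⟨fun f s => ⟨fun x => f x • s x, f.contMDiff.smul_section s.contMDiff⟩⟩

@[simp] theorem smulSection_apply (f : C^∞⟮𝓘(ℝ, H), M; ℝ⟯) (s : Cₛ^∞⟮𝓘(ℝ, H); F, E⟯) (x : M) :
    (f • s) x = f x • s x := rfl

/-- `Γ(E)` is a module over `C^∞(M)`. -/
instance instModuleSection :
    Module C^∞⟮𝓘(ℝ, H), M; ℝ⟯ Cₛ^∞⟮𝓘(ℝ, H); F, E⟯ where
  one_smul s := by ext x; simp
  mul_smul f g s := by ext x; simp [mul_smul]
  smul_zero f := by ext x; simp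
  smul_add f s t := by ext x; simp
  add_smul f g s := by ext x; simp [add_smul]
  zero_smul s := by ext x; simp

instance instTowerSection :
    IsScalarTower ℝ C^∞⟮𝓘(ℝ, H), M; ℝ⟯ Cₛ^∞⟮𝓘(ℝ, H); F, E⟯ :=
  ⟨fun c f s => by ext x; simp [mul_smul]⟩

/-- The pairing `Γ(E*) × Γ(E) → C^∞(M)`. -/
def sectionPairing (ξ : Cₛ^∞⟮𝓘(ℝ, H); F →L[ℝ] ℝ, fun x : M => E x →L[ℝ] Trivial M ℝ x⟯)
    (u : Cₛ^∞⟮𝓘(ℝ, H); F, E⟯) : C^∞⟮𝓘(ℝ, H), M; ℝ⟯ :=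
  ⟨fun x => ξ x (u x), by
    have h := ContMDiff.clm_bundle_apply (F₂ := ℝ) (E₂ := Trivial M ℝ) ξ.contMDiff u.contMDiff
    exact fun x => ((contMDiffAt_section x).1 (h x))⟩

end SmoothSections

section Dual

variable {H : Type*} [NormedAddCommGroup H] [NormedSpace ℝ H] [FiniteDimensional ℝ H]
  {M : Type*} [TopologicalSpace M] [T2Space M] [ChartedSpace H M] [IsManifold 𝓘(ℝ, H) ∞ M]
  {F : Type*} [NormedAddCommGroup F] [NormedSpace ℝ F] [FiniteDimensional ℝ F]
  {E : M → Type*} [TopologicalSpace (TotalSpace F E)]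
  [∀ x, AddCommGroup (E x)] [∀ x, Module ℝ (E x)] [∀ x, TopologicalSpace (E x)]
  [FiberBundle F E] [VectorBundle ℝ F E] [ContMDiffVectorBundle ∞ F E 𝓘(ℝ, H)]

/-- Around every point there are finitely many global smooth sections that form a frame near the
point, together with a description of evaluations of `C^∞(M)`-linear functionals in this frame. -/
theorem exists_sections_frame (m₀ : M) :
    ∃ s : Module.Basis.ofVectorSpaceIndex ℝ F → Cₛ^∞⟮𝓘(ℝ, H); F, E⟯,
      ∀ᶠ m in nhds m₀, ∃ hm : m ∈ (trivializationAt F E m₀).baseSet,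
        (∀ i, s i m = (trivializationAt F E m₀).basisAt (Module.Basis.ofVectorSpace ℝ F) hm i) ∧
        ∀ (φ : Module.Dual C^∞⟮𝓘(ℝ, H), M; ℝ⟯ Cₛ^∞⟮𝓘(ℝ, H); F, E⟯)
          (u : Cₛ^∞⟮𝓘(ℝ, H); F, E⟯),
          φ u m = ∑ i, ((trivializationAt F E m₀).basisAt
            (Module.Basis.ofVectorSpace ℝ F) hm).repr (u m) i * φ (s i) m := by
  classical
  set e := trivializationAt F E m₀ with he
  set b := Module.Basis.ofVectorSpace ℝ F with hb
  have : ContMDiffVectorBundle 1 F E 𝓘(ℝ, H) := ContMDiffVectorBundle.of_le (n := ∞) (by simp)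
  have hm₀ : m₀ ∈ e.baseSet := FiberBundle.mem_baseSet_trivializationAt' m₀
  obtain ⟨ψ, -, hψ⟩ := (SmoothBumpFunction.nhds_basis_tsupport (I := 𝓘(ℝ, H)) m₀).mem_iff.1
    (e.open_baseSet.mem_nhds hm₀)
  let ψ' : C^∞⟮𝓘(ℝ, H), M; ℝ⟯ := ⟨ψ, ψ.contMDiff⟩
  let s : Module.Basis.ofVectorSpaceIndex ℝ F → Cₛ^∞⟮𝓘(ℝ, H); F, E⟯ := fun i =>
    ⟨(ψ : M → ℝ) • e.localFrame b i, ContMDiffOn.smul_section_of_tsupport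
      ψ.contMDiff.contMDiffOn e.open_baseSet hψ (e.contMDiffOn_localFrame_baseSet ∞ b i)⟩
  have hc : ∀ (u : Cₛ^∞⟮𝓘(ℝ, H); F, E⟯) i,
      ContMDiff 𝓘(ℝ, H) 𝓘(ℝ) ∞ (fun m => ψ m • e.localFrameCoeff 𝓘(ℝ, H) b i m (u m)) := by
    intro u i
    have h1 : ContMDiffOn 𝓘(ℝ, H) 𝓘(ℝ) ∞ (fun m => e.localFrameCoeff 𝓘(ℝ, H) b i m (u m))
        e.baseSet := contMDiffOn_localFrameCoeff b e.open_baseSet subset_rfl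
          u.contMDiff.contMDiffOn i
    refine contMDiff_of_tsupport fun m hm => ?_
    have hm' : m ∈ e.baseSet := hψ (tsupport_smul_subset_left _ _ hm)
    exact (ψ.contMDiff m).smul (h1.contMDiffAt (e.open_baseSet.mem_nhds hm'))
  let c : Cₛ^∞⟮𝓘(ℝ, H); F, E⟯ → Module.Basis.ofVectorSpaceIndex ℝ F → C^∞⟮𝓘(ℝ, H), M; ℝ⟯ :=
    fun u i => ⟨_, hc u i⟩
  refine ⟨s, ?_⟩
  filter_upwards [ψ.eventuallyEq_one, e.open_baseSet.mem_nhds hm₀] with m hm1 hm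
  simp only [Pi.one_apply] at hm1
  refine ⟨hm, fun i => ?_, fun φ u => ?_⟩
  · change ψ m • e.localFrame b i m = _
    rw [hm1, one_smul, Trivialization.localFrame_apply_of_mem_baseSet]
  · have key : (ψ' * ψ') • u = ∑ i, c u i • s i := by
      ext x
      have hsum : ∀ (t : Finset (Module.Basis.ofVectorSpaceIndex ℝ F))
          (g : Module.Basis.ofVectorSpaceIndex ℝ F → Cₛ^∞⟮𝓘(ℝ, H); F, E⟯),
          (∑ i ∈ t, g i) x = ∑ i ∈ t, g i x := fun t g =>
        map_sum ((Pi.evalAddMonoidHom E x).comp (ContMDiffSection.coeAddHom 𝓘(ℝ, H) F ∞ E)) g t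
      rw [hsum]
      by_cases hx : x ∈ e.baseSet
      · change (ψ x * ψ x) • u x = ∑ i, (ψ x • e.localFrameCoeff 𝓘(ℝ, H) b i x (u x)) •
          (ψ x • e.localFrame b i x)
        conv_lhs => rw [e.eq_sum_localFrameCoeff_smul (I := 𝓘(ℝ, H)) (b := b) (s := u) hx]
        rw [Finset.smul_sum]
        refine Finset.sum_congr rfl fun i _ => ?_
        simp only [smul_smul, smul_eq_mul]
        congr 1; ring
      · have h0 : ψ x = 0 := image_eq_zero_of_notMem_tsupport fun h => hx (hψ h)
        change (ψ x * ψ x) • u x = ∑ i, (ψ x • e.localFrameCoeff 𝓘(ℝ, H) b i x (u x)) •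
          (ψ x • e.localFrame b i x)
        simp [h0]
    have h2 := congrArg (fun v => φ v m) key
    simp only [map_smul, map_sum] at h2
    have hsum : ∀ (g : Module.Basis.ofVectorSpaceIndex ℝ F → C^∞⟮𝓘(ℝ, H), M; ℝ⟯),
        (∑ i, g i) m = ∑ i, g i m := fun g => map_sum (ContMDiffMap.evalRingHom m) g _
    rw [hsum] at h2
    change (ψ m * ψ m) * φ u m = ∑ i, (ψ m * e.localFrameCoeff 𝓘(ℝ, H) b i m (u m)) * φ (s i) m
      at h2
    simp only [hm1, one_mul] at h2
    rw [h2]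
    refine Finset.sum_congr rfl fun i _ => ?_
    rw [Trivialization.localFrameCoeff_apply_of_mem_baseSet e b hm u i]

/-- Through every vector of `E` passes a global smooth section. -/
theorem exists_section_apply_eq (m : M) (v : E m) : ∃ u : Cₛ^∞⟮𝓘(ℝ, H); F, E⟯, u m = v := by
  obtain ⟨s, hs⟩ := exists_sections_frame (H := H) (F := F) (E := E) m
  obtain ⟨hm, hs, -⟩ := hs.self_of_nhds
  set B := (trivializationAt F E m).basisAt (Module.Basis.ofVectorSpace ℝ F) hm
  refine ⟨∑ i, B.repr v i • s i, ?_⟩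
  have hsum : ∀ (g : Module.Basis.ofVectorSpaceIndex ℝ F → Cₛ^∞⟮𝓘(ℝ, H); F, E⟯),
      (∑ i, g i) m = ∑ i, g i m := fun g =>
    map_sum ((Pi.evalAddMonoidHom E m).comp (ContMDiffSection.coeAddHom 𝓘(ℝ, H) F ∞ E)) g _
  rw [hsum]
  simp only [ContMDiffSection.coe_smul, Pi.smul_apply, hs]
  exact B.sum_repr v

/-- The pairing as a `C^∞(M)`-linear map `Γ(E*) → Hom(Γ(E), C^∞(M))`. -/
def sectionPairingHom : Cₛ^∞⟮𝓘(ℝ, H); F →L[ℝ] ℝ, fun x : M => E x →L[ℝ] Trivial M ℝ x⟯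
    →ₗ[C^∞⟮𝓘(ℝ, H), M; ℝ⟯] Module.Dual C^∞⟮𝓘(ℝ, H), M; ℝ⟯ Cₛ^∞⟮𝓘(ℝ, H); F, E⟯ :=
  LinearMap.mk₂ _ sectionPairing
    (fun _ _ _ => rfl) (fun _ _ _ => rfl)
    (fun ξ u v => by ext x; exact (ξ x).map_add (u x) (v x))
    (fun f ξ u => by ext x; exact (ξ x).map_smul (f x) (u x))

theorem sectionPairingHom_bijective : Function.Bijective
    (sectionPairingHom (H := H) (F := F) (E := E)) := by
  classical
  constructor
  · intro ξ η h
    ext m v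
    obtain ⟨u, rfl⟩ := exists_section_apply_eq (H := H) (F := F) m v
    exact congrArg (fun f : C^∞⟮𝓘(ℝ, H), M; ℝ⟯ => f m) (LinearMap.congr_fun h u)
  · intro φ
    have hex : ∀ m : M, ∃ ξ : E m →L[ℝ] ℝ, ∀ u : Cₛ^∞⟮𝓘(ℝ, H); F, E⟯, ξ (u m) = φ u m := by
      intro m
      have : T2Space (E m) := FiberBundle.t2Space F E m
      have : FiniteDimensional ℝ (E m) := VectorBundle.finiteDimensional ℝ F E m
      have : IsTopologicalAddGroup (E m) :=
        (VectorBundle.continuousLinearEquivAt ℝ F E m).toContinuousAddEquiv.isTopologicalAddGroup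
      have : ContinuousSMul ℝ (E m) :=
        (VectorBundle.continuousLinearEquivAt ℝ F E m).continuousSMul
      obtain ⟨s, hs⟩ := exists_sections_frame (H := H) (F := F) (E := E) m
      obtain ⟨hm, -, hφ⟩ := hs.self_of_nhds
      set B := (trivializationAt F E m).basisAt (Module.Basis.ofVectorSpace ℝ F) hm
      refine ⟨LinearMap.toContinuousLinearMap (∑ i, (φ (s i) m) • B.coord i), fun u => ?_⟩
      rw [hφ φ u]
      simp [mul_comm]
    choose ξ hξ using hex
    refine ⟨⟨ξ, fun m₀ => ?_⟩, ?_⟩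
    · rw [contMDiffAt_hom_bundle]
      refine ⟨contMDiffAt_id, ?_⟩
      obtain ⟨s, hs⟩ := exists_sections_frame (H := H) (F := F) (E := E) m₀
      let b := Module.Basis.ofVectorSpace ℝ F
      have hsm : ContMDiffAt 𝓘(ℝ, H) 𝓘(ℝ, F →L[ℝ] ℝ) ∞
          (fun m => ∑ i, φ (s i) m • LinearMap.toContinuousLinearMap (b.coord i)) m₀ := by
        refine ContMDiffAt.sum fun i _ => ?_
        exact ((φ (s i)).contMDiff m₀).smul contMDiffAt_const
      refine hsm.congr_of_eventuallyEq ?_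
      filter_upwards [hs] with m hm
      obtain ⟨hm, hsi, -⟩ := hm
      refine ContinuousLinearMap.coe_injective (b.ext fun j => ?_)
      have h1 : (trivializationAt F E m₀).symm m (b j) = s j m := by
        rw [hsi j]; simp [Trivialization.basisAt, b]
      have h2 : ContinuousLinearMap.inCoordinates F E ℝ (Trivial M ℝ) m₀ m m₀ m (ξ m) (b j)
          = φ (s j) m := by
        rw [ContinuousLinearMap.inCoordinates_eq hm (by simp)]
        simp [h1, hξ]
      simp only [ContinuousLinearMap.coe_coe]
      rw [h2]
      simp [Finsupp.single_apply]
    · ext u m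
      exact hξ m u

/-- `Γ(E*) ≃ Hom(Γ(E), C^∞(M))`. -/
def dualSections : Cₛ^∞⟮𝓘(ℝ, H); F →L[ℝ] ℝ, fun x : M => E x →L[ℝ] Trivial M ℝ x⟯
    ≃ₗ[C^∞⟮𝓘(ℝ, H), M; ℝ⟯] Module.Dual C^∞⟮𝓘(ℝ, H), M; ℝ⟯ Cₛ^∞⟮𝓘(ℝ, H); F, E⟯ :=
  LinearEquiv.ofBijective sectionPairingHom sectionPairingHom_bijective

end Dual

/-!
### Calculus of sections

In this part `R` plays the role of the algebra `C^∞(M)`, `Γ` that of the module of smooth sections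
of a vector bundle `E → M`, and `Γ'` that of the module of smooth sections of `E*`, paired with `Γ`
through `D : Γ' ≃ Hom_R(Γ, R)`. Bundle maps over the identity are the same as `R`-linear maps
between modules of sections, and vector fields are the same as derivations of `C^∞(M)`.
-/

set_option linter.unusedSectionVars false

section Calculus

variable {R : Type*} [CommRing R] [Algebra ℝ R]
  {Γ : Type*} [AddCommGroup Γ] [Module ℝ Γ] [Module R Γ] [IsScalarTower ℝ R Γ]
  {Γ' : Type*} [AddCommGroup Γ'] [Module ℝ Γ'] [Module R Γ'] [IsScalarTower ℝ R Γ']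

/-- A Lie algebroid structure on a vector bundle with module of sections `L`: a Lie bracket on
sections and an anchor to the tangent bundle that satisfy the Leibniz rule
`[u, f v] = f [u, v] + ρ(u)(f) v`. -/
structure LieAlgebroid (R L : Type*) [CommRing R] [Algebra ℝ R] [AddCommGroup L] [Module ℝ L]
    [Module R L] where
  bracket : L →ₗ[ℝ] L →ₗ[ℝ] L
  anchor : L →ₗ[R] Derivation ℝ R R
  bracket_self : ∀ u, bracket u u = 0
  jacobi : ∀ u v w, bracket u (bracket v w) = bracket (bracket u v) w + bracket v (bracket u w)
  leibniz : ∀ u (f : R) v, bracket u (f • v) = f • bracket u v + anchor u f • v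
  anchor_bracket : ∀ u v, anchor (bracket u v) = ⁅anchor u, anchor v⁆

theorem LieAlgebroid.skew (A : LieAlgebroid R Γ) (u v : Γ) :
    A.bracket u v = -A.bracket v u := by
  have h := A.bracket_self (u + v)
  simp only [map_add, LinearMap.add_apply, A.bracket_self, zero_add, add_zero] at h
  rw [add_comm] at h
  exact eq_neg_of_add_eq_zero_left (by rw [← h])

theorem LieAlgebroid.smul_bracket (A : LieAlgebroid R Γ) (f : R) (u v : Γ) :
    A.bracket (f • u) v = f • A.bracket u v - A.anchor v f • u := by
  rw [A.skew, A.leibniz, A.skew v u]; simp [sub_eq_add_neg, add_comm]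

/-! #### The gauge Lie algebroid -/

variable (R Γ) in
/-- Sections of the gauge Lie algebroid `𝔇E`: pairs of an `ℝ`-linear operator `δ` on sections of
`E` and a vector field `x`, its image under the anchor `α`, with `δ(f u) = f δ(u) + x(f) u`. -/
def gaugeSubmodule : Submodule R ((Γ →ₗ[ℝ] Γ) × Derivation ℝ R R) where
  carrier := {p | ∀ (f : R) (u : Γ), p.1 (f • u) = f • p.1 u + p.2 f • u}
  add_mem' {p q} hp hq f u := by
    simp only [Prod.fst_add, Prod.snd_add, LinearMap.add_apply, Derivation.add_apply, hp f u,
      hq f u]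
    module
  zero_mem' f u := by simp
  smul_mem' g p hp f u := by
    simp only [Prod.smul_fst, Prod.smul_snd, LinearMap.smul_apply, Derivation.smul_apply, hp f u,
      smul_eq_mul]
    module

variable (R Γ) in
/-- Sections of the gauge Lie algebroid `𝔇E`. -/
abbrev Gauge : Type _ := ↥(gaugeSubmodule R Γ)

namespace Gauge

/-- The operator on sections of `E` given by a section of `𝔇E`. -/
def op (δ : Gauge R Γ) : Γ →ₗ[ℝ] Γ := δ.1.1

/-- The anchor `α : 𝔇E → TM`. -/
def symbol (δ : Gauge R Γ) : Derivation ℝ R R := δ.1.2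

theorem op_smul (δ : Gauge R Γ) (f : R) (u : Γ) :
    δ.op (f • u) = f • δ.op u + δ.symbol f • u := δ.2 f u

@[ext] theorem ext {δ ε : Gauge R Γ} (h : ∀ u, δ.op u = ε.op u)
    (h' : ∀ f, δ.symbol f = ε.symbol f) : δ = ε :=
  Subtype.ext (Prod.ext (LinearMap.ext h) (Derivation.ext h'))

@[simp] theorem op_add (δ ε : Gauge R Γ) (u : Γ) : (δ + ε).op u = δ.op u + ε.op u := rfl
@[simp] theorem symbol_add (δ ε : Gauge R Γ) (f : R) :
    (δ + ε).symbol f = δ.symbol f + ε.symbol f := rfl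
@[simp] theorem smul_op (f : R) (δ : Gauge R Γ) (u : Γ) : (f • δ).op u = f • δ.op u := rfl
@[simp] theorem smul_symbol (g : R) (δ : Gauge R Γ) (f : R) :
    (g • δ).symbol f = g * δ.symbol f := rfl

/-- The commutator bracket on sections of `𝔇E`. -/
def bracket (δ ε : Gauge R Γ) : Gauge R Γ :=
  ⟨(δ.op ∘ₗ ε.op - ε.op ∘ₗ δ.op, ⁅δ.symbol, ε.symbol⁆), fun f u => by
    simp only [LinearMap.sub_apply, LinearMap.comp_apply, op_smul, map_add,
      Derivation.commutator_apply]
    module⟩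

@[simp] theorem bracket_op (δ ε : Gauge R Γ) (u : Γ) :
    (bracket δ ε).op u = δ.op (ε.op u) - ε.op (δ.op u) := rfl
@[simp] theorem bracket_symbol (δ ε : Gauge R Γ) (f : R) :
    (bracket δ ε).symbol f = δ.symbol (ε.symbol f) - ε.symbol (δ.symbol f) := rfl

/-- The embedding `𝔦 : gl(E) → 𝔇E`. -/
def ofEnd (Φ : Γ →ₗ[R] Γ) : Gauge R Γ :=
  ⟨(Φ.restrictScalars ℝ, 0), fun f u => by simp⟩

@[simp] theorem ofEnd_op (Φ : Γ →ₗ[R] Γ) (u : Γ) : (ofEnd Φ).op u = Φ u := rfl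
@[simp] theorem ofEnd_symbol (Φ : Γ →ₗ[R] Γ) (f : R) : (ofEnd Φ).symbol f = 0 := rfl

end Gauge

/-- The section `[u, ·]` of `𝔇E` defined by a section `u` of a Lie algebroid `E`. -/
def LieAlgebroid.ad (A : LieAlgebroid R Γ) (u : Γ) : Gauge R Γ :=
  ⟨(A.bracket u, A.anchor u), A.leibniz u⟩

@[simp] theorem LieAlgebroid.ad_op (A : LieAlgebroid R Γ) (u v : Γ) :
    (A.ad u).op v = A.bracket u v := rfl
@[simp] theorem LieAlgebroid.ad_symbol (A : LieAlgebroid R Γ) (u : Γ) (f : R) :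
    (A.ad u).symbol f = A.anchor u f := rfl

/-! #### The jet bundle -/

variable (R Γ) in
/-- Sections of the jet bundle `𝔍E`, as the `E`-dual of `𝔇E`:
`𝔍E = {ν ∈ Hom(𝔇E, E) | ν(Φ) = Φ(ν(1_E)) for all Φ ∈ gl(E)}`. -/
def jetSubmodule : Submodule R (Gauge R Γ →ₗ[R] Γ) where
  carrier := {ν | ∀ Φ : Γ →ₗ[R] Γ, ν (Gauge.ofEnd Φ) = Φ (ν (Gauge.ofEnd LinearMap.id))}
  add_mem' hμ hν Φ := by simp [hμ Φ, hν Φ]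
  zero_mem' Φ := by simp
  smul_mem' f ν hν Φ := by simp [hν Φ]

variable (R Γ) in
/-- Sections of the jet bundle `𝔍E`. -/
abbrev Jet : Type _ := ↥(jetSubmodule R Γ)

namespace Jet

/-- The `E`-valued pairing of `𝔍E` with `𝔇E`. -/
def pair (μ : Jet R Γ) : Gauge R Γ →ₗ[R] Γ := μ.1

@[ext] theorem ext {μ ν : Jet R Γ} (h : ∀ δ, μ.pair δ = ν.pair δ) : μ = ν :=
  Subtype.ext (LinearMap.ext h)

@[simp] theorem add_pair (μ ν : Jet R Γ) (δ : Gauge R Γ) :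
    (μ + ν).pair δ = μ.pair δ + ν.pair δ := rfl
@[simp] theorem smul_pair (f : R) (μ : Jet R Γ) (δ : Gauge R Γ) :
    (f • μ).pair δ = f • μ.pair δ := rfl

/-- The projection `𝕡 : 𝔍E → E`. -/
def proj (μ : Jet R Γ) : Γ := μ.pair (Gauge.ofEnd LinearMap.id)

theorem pair_ofEnd (μ : Jet R Γ) (Φ : Γ →ₗ[R] Γ) : μ.pair (Gauge.ofEnd Φ) = Φ μ.proj := μ.2 Φ

/-- The jet prolongation `𝕕u` of a section `u` of `E`. -/
def prolong (u : Γ) : Jet R Γ :=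
  ⟨{ toFun := fun δ => δ.op u
     map_add' := fun _ _ => rfl
     map_smul' := fun _ _ => rfl }, fun _ => rfl⟩

@[simp] theorem prolong_pair (u : Γ) (δ : Gauge R Γ) : (prolong u).pair δ = δ.op u := rfl

/-- The section `df ⊗ u` of `Hom(TM, E) ⊆ 𝔍E`. -/
def dTensor (f : R) (u : Γ) : Jet R Γ :=
  ⟨{ toFun := fun δ => δ.symbol f • u
     map_add' := fun δ ε => by simp [add_smul]
     map_smul' := fun g δ => by simp [mul_smul] }, fun Φ => by
    simp⟩

@[simp] theorem dTensor_pair (f : R) (u : Γ) (δ : Gauge R Γ) :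
    (dTensor f u).pair δ = δ.symbol f • u := rfl

/-- The Lie derivative of sections of `𝔍E` along a section of `𝔇E`:
`⟨L_δ μ, ε⟩ = δ⟨μ, ε⟩ - ⟨μ, [δ, ε]⟩`. -/
def lieDeriv (δ : Gauge R Γ) (μ : Jet R Γ) : Jet R Γ :=
  ⟨{ toFun := fun ε => δ.op (μ.pair ε) - μ.pair (Gauge.bracket δ ε)
     map_add' := fun ε ε' => by
       have h : Gauge.bracket δ (ε + ε') = Gauge.bracket δ ε + Gauge.bracket δ ε' := by
         ext <;> simp <;> abel
       rw [h]; simp only [map_add]; abel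
     map_smul' := fun f ε => by
       have h : Gauge.bracket δ (f • ε) = f • Gauge.bracket δ ε + δ.symbol f • ε := by
         ext <;> simp [Gauge.op_smul, smul_sub, mul_sub]
         · abel
         · ring
       rw [h]; simp only [map_add, map_smul, Gauge.op_smul, RingHom.id_apply, smul_sub]; abel },
   fun Φ => by
    let Ψ : Γ →ₗ[R] Γ :=
      { toFun := fun u => δ.op (Φ u) - Φ (δ.op u)
        map_add' := fun u v => by simp only [map_add]; abel
        map_smul' := fun f u => by
          simp only [map_smul, Gauge.op_smul, map_add, RingHom.id_apply, smul_sub]; abel }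
    have h1 : Gauge.bracket δ (Gauge.ofEnd Φ) = Gauge.ofEnd Ψ := by
      ext <;> simp [Ψ]
    have h2 : Gauge.bracket δ (Gauge.ofEnd (LinearMap.id : Γ →ₗ[R] Γ)) = 0 := by
      ext
      · simp; rfl
      · simp; rfl
    change δ.op (μ.pair _) - μ.pair _ = Φ (δ.op (μ.pair _) - μ.pair _)
    rw [h1, h2, pair_ofEnd, pair_ofEnd, pair_ofEnd]
    simp [Ψ]⟩

@[simp] theorem lieDeriv_pair (δ : Gauge R Γ) (μ : Jet R Γ) (ε : Gauge R Γ) :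
    (lieDeriv δ μ).pair ε = δ.op (μ.pair ε) - μ.pair (Gauge.bracket δ ε) := rfl

end Jet

namespace LieAlgebroid

/-- The adjoint representation `π : 𝔍E → 𝔇E` of a Lie algebroid `E`, the bundle map with
`π(𝕕u)(v) = [u, v]`. On a general section it is `π(μ)(v) = -⟨μ, [v, ·]⟩`. -/
def adjoint (A : LieAlgebroid R Γ) : Jet R Γ →ₗ[R] Gauge R Γ where
  toFun μ := ⟨({ toFun := fun v => -μ.pair (A.ad v)
                 map_add' := fun v w => by
                   have h : A.ad (v + w) = A.ad v + A.ad w := by ext <;> simp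
                   rw [h, map_add]; abel
                 map_smul' := fun c v => by
                   have h : A.ad (c • v) = (algebraMap ℝ R c) • A.ad v := by
                     rw [← algebraMap_smul R c v]
                     ext
                     · rw [ad_op, smul_bracket, Gauge.smul_op]; simp
                     · rw [ad_symbol, Gauge.smul_symbol, map_smul, Derivation.smul_apply]; simp
                   rw [h, map_smul, algebraMap_smul, RingHom.id_apply, smul_neg] },
               A.anchor μ.proj), fun f v => by
      let Φ : Γ →ₗ[R] Γ :=
        { toFun := fun w => A.anchor w f • v
          map_add' := fun w w' => by simp [add_smul]
          map_smul' := fun g w => by simp [mul_smul] }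
      have h : A.ad (f • v) = f • A.ad v - Gauge.ofEnd Φ := by
        rw [eq_sub_iff_add_eq]
        ext <;> simp [smul_bracket, Φ]
      change -μ.pair (A.ad (f • v)) = f • -μ.pair (A.ad v) + A.anchor μ.proj f • v
      rw [h, map_sub, map_smul, Jet.pair_ofEnd]
      simp only [Φ, LinearMap.coe_mk, AddHom.coe_mk, smul_neg]; abel⟩
  map_add' μ ν := by
    refine Gauge.ext (fun v => ?_) (fun f => ?_)
    · change -(μ + ν).pair (A.ad v) = -μ.pair (A.ad v) + -ν.pair (A.ad v)
      simp; abel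
    · change A.anchor (μ + ν).proj f = A.anchor μ.proj f + A.anchor ν.proj f
      simp [Jet.proj]
  map_smul' g μ := by
    refine Gauge.ext (fun v => ?_) (fun f => ?_)
    · change -(g • μ).pair (A.ad v) = g • -μ.pair (A.ad v)
      simp
    · change A.anchor (g • μ).proj f = g * A.anchor μ.proj f
      simp [Jet.proj]

theorem adjoint_op (A : LieAlgebroid R Γ) (μ : Jet R Γ) (v : Γ) :
    (A.adjoint μ).op v = -μ.pair (A.ad v) := rfl

theorem adjoint_prolong (A : LieAlgebroid R Γ) (u : Γ) :
    A.adjoint (Jet.prolong u) = A.ad u := by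
  ext v
  · rw [adjoint_op, Jet.prolong_pair, ad_op, ad_op, A.skew u v]
  · rfl

/-- The bracket of the jet Lie algebroid:
`[μ, ν]_π = L_{π(μ)} ν - L_{π(ν)} μ - 𝕕⟨π(μ), ν⟩`. -/
def jetBracket (A : LieAlgebroid R Γ) (μ ν : Jet R Γ) : Jet R Γ :=
  Jet.lieDeriv (A.adjoint μ) ν - Jet.lieDeriv (A.adjoint ν) μ
    - Jet.prolong (ν.pair (A.adjoint μ))

end LieAlgebroid

/-! #### Bivectors -/

variable (R Γ') in
/-- Sections of `∧²E`, as alternating bilinear forms on `E*`. -/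
abbrev Bivector : Type _ := Γ' [⋀^Fin 2]→ₗ[R] R

namespace Bivector

theorem apply_swap (W : Bivector R Γ') (ξ η : Γ') : W ![ξ, η] = -W ![η, ξ] := by
  have h := W.map_swap ![η, ξ] (i := 0) (j := 1) (by decide)
  rw [← h]; congr 1; ext i; fin_cases i <;> rfl

/-- The value of a bivector on two sections of `E*`. -/
def eval (W : Bivector R Γ') : Γ' →ₗ[R] Γ' →ₗ[R] R :=
  LinearMap.mk₂ R (fun ξ η => W ![ξ, η])
    (fun ξ ξ' η => W.map_vecCons_add ![η] ξ ξ')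
    (fun f ξ η => W.map_vecCons_smul ![η] f ξ)
    (fun ξ η η' => by
      rw [W.apply_swap, W.apply_swap ξ η, W.apply_swap ξ η', W.map_vecCons_add ![ξ] η η', neg_add])
    (fun f ξ η => by
      rw [W.apply_swap, W.apply_swap ξ η, W.map_vecCons_smul ![ξ] f η, smul_neg])

theorem eval_apply (W : Bivector R Γ') (ξ η : Γ') : W.eval ξ η = W ![ξ, η] := rfl

theorem eval_skew (W : Bivector R Γ') (ξ η : Γ') : W.eval ξ η = -W.eval η ξ := W.apply_swap ξ η

@[simp] theorem eval_self (W : Bivector R Γ') (ξ : Γ') : W.eval ξ ξ = 0 :=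
  W.map_eq_zero_of_eq ![ξ, ξ] (i := 0) (j := 1) rfl (by decide)

theorem ext_eval {V W : Bivector R Γ'} (h : ∀ ξ η, V.eval ξ η = W.eval ξ η) : V = W := by
  ext v
  have hv : v = ![v 0, v 1] := by ext i; fin_cases i <;> rfl
  rw [hv]; exact h _ _

/-- The bivector given by an alternating bilinear form. -/
def ofForm (B : Γ' →ₗ[R] Γ' →ₗ[R] R) (hB : ∀ ξ, B ξ ξ = 0) : Bivector R Γ' where
  toFun v := B (v 0) (v 1)
  map_update_add' := by
    intro inst v i x y
    have h : inst = instDecidableEqFin 2 := Subsingleton.elim _ _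
    subst h
    fin_cases i <;> simp
  map_update_smul' := by
    intro inst v i c x
    have h : inst = instDecidableEqFin 2 := Subsingleton.elim _ _
    subst h
    fin_cases i <;> simp
  map_eq_zero_of_eq' := by
    intro v i j hij hne
    have : v 0 = v 1 := by
      fin_cases i <;> fin_cases j <;> simp_all
    rw [this]; exact hB _

@[simp] theorem ofForm_eval (B : Γ' →ₗ[R] Γ' →ₗ[R] R) (hB : ∀ ξ, B ξ ξ = 0) (ξ η : Γ') :
    (ofForm B hB).eval ξ η = B ξ η := rfl

/-- The wedge product of two sections of `E = E**`, seen as linear forms on `E*`. -/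
def wedge (a b : Module.Dual R Γ') : Bivector R Γ' :=
  ofForm (LinearMap.mk₂ R (fun ξ η => a ξ * b η - a η * b ξ)
    (fun _ _ _ => by simp only [map_add]; ring)
    (fun _ _ _ => by simp only [map_smul, smul_eq_mul]; ring)
    (fun _ _ _ => by simp only [map_add]; ring)
    (fun _ _ _ => by simp only [map_smul, smul_eq_mul]; ring))
   (fun ξ => by simp)

end Bivector

/-- The dual operator of a section of `𝔇E` on sections of `E*`:
`⟨δ*ξ, u⟩ = x(⟨ξ, u⟩) - ⟨ξ, δ u⟩`, where `x` is the symbol of `δ`. -/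
def Gauge.dual (D : Γ' ≃ₗ[R] Module.Dual R Γ) (δ : Gauge R Γ) (ξ : Γ') : Γ' :=
  D.symm
    { toFun := fun u => δ.symbol (D ξ u) - D ξ (δ.op u)
      map_add' := fun u v => by simp only [map_add]; abel
      map_smul' := fun f u => by
        simp only [map_smul, Gauge.op_smul, map_add, smul_eq_mul, Derivation.leibniz,
          RingHom.id_apply]
        ring }

theorem Gauge.dual_pair (D : Γ' ≃ₗ[R] Module.Dual R Γ) (δ : Gauge R Γ) (ξ : Γ') (u : Γ) :
    D (δ.dual D ξ) u = δ.symbol (D ξ u) - D ξ (δ.op u) := by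
  simp [Gauge.dual]

theorem Gauge.dual_add (D : Γ' ≃ₗ[R] Module.Dual R Γ) (δ : Gauge R Γ) (ξ η : Γ') :
    δ.dual D (ξ + η) = δ.dual D ξ + δ.dual D η := by
  apply D.injective; ext u
  simp only [map_add, LinearMap.add_apply, Gauge.dual_pair]; abel

theorem Gauge.dual_smul (D : Γ' ≃ₗ[R] Module.Dual R Γ) (δ : Gauge R Γ) (f : R) (ξ : Γ') :
    δ.dual D (f • ξ) = f • δ.dual D ξ + δ.symbol f • ξ := by
  apply D.injective; ext u
  simp only [map_add, map_smul, LinearMap.add_apply, LinearMap.smul_apply, Gauge.dual_pair,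
    smul_eq_mul, Derivation.leibniz]
  ring

/-- The induced (tensor) action of a section of `𝔇E` on sections of `∧²E`:
`(δW)(ξ, η) = x(W(ξ, η)) - W(δ*ξ, η) - W(ξ, δ*η)`. -/
def Gauge.act (D : Γ' ≃ₗ[R] Module.Dual R Γ) (δ : Gauge R Γ) (W : Bivector R Γ') :
    Bivector R Γ' :=
  Bivector.ofForm (LinearMap.mk₂ R
    (fun ξ η => δ.symbol (W.eval ξ η) - W.eval (δ.dual D ξ) η - W.eval ξ (δ.dual D η))
    (fun ξ ξ' η => by simp only [map_add, LinearMap.add_apply, Gauge.dual_add]; ring)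
    (fun f ξ η => by
      simp only [map_add, map_smul, LinearMap.add_apply, LinearMap.smul_apply, Gauge.dual_smul,
        smul_eq_mul, Derivation.leibniz]; ring)
    (fun ξ η η' => by simp only [map_add, Gauge.dual_add]; ring)
    (fun f ξ η => by
      simp only [map_add, map_smul, Gauge.dual_smul, smul_eq_mul, Derivation.leibniz]; ring))
   (fun ξ => by simp [W.eval_skew ξ (δ.dual D ξ)])

@[simp] theorem Gauge.act_eval (D : Γ' ≃ₗ[R] Module.Dual R Γ) (δ : Gauge R Γ) (W : Bivector R Γ')
    (ξ η : Γ') : (δ.act D W).eval ξ η =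
      δ.symbol (W.eval ξ η) - W.eval (δ.dual D ξ) η - W.eval ξ (δ.dual D η) := rfl

/-- On decomposable bivectors the induced action is `δ(u ∧ v) = δu ∧ v + u ∧ δv`. -/
theorem Gauge.act_wedge (D : Γ' ≃ₗ[R] Module.Dual R Γ) (δ : Gauge R Γ) (u v : Γ) :
    δ.act D (Bivector.wedge (D.toLinearMap.flip u) (D.toLinearMap.flip v)) =
      Bivector.wedge (D.toLinearMap.flip (δ.op u)) (D.toLinearMap.flip v) +
        Bivector.wedge (D.toLinearMap.flip u) (D.toLinearMap.flip (δ.op v)) := by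
  refine Bivector.ext_eval fun ξ η => ?_
  change δ.symbol (D ξ u * D η v - D η u * D ξ v)
      - (D (δ.dual D ξ) u * D η v - D η u * D (δ.dual D ξ) v)
      - (D ξ u * D (δ.dual D η) v - D (δ.dual D η) u * D ξ v)
    = (D ξ (δ.op u) * D η v - D η (δ.op u) * D ξ v)
      + (D ξ u * D η (δ.op v) - D η u * D ξ (δ.op v))
  simp only [Gauge.dual_pair, map_sub, Derivation.leibniz, smul_eq_mul]
  ring

/-! #### Lie bialgebroids -/

/-- The Schouten bracket `[u, W]` of a section `u` of the Lie algebroid `E` and a section `W` of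
`∧²E`, the extension of the Lie bracket `[u, ·]` as a derivation of the wedge product. -/
def LieAlgebroid.schouten (D : Γ' ≃ₗ[R] Module.Dual R Γ) (A : LieAlgebroid R Γ) (u : Γ)
    (W : Bivector R Γ') : Bivector R Γ' :=
  (A.ad u).act D W

/-- The Schouten bracket `[W, u] = -[u, W]`. -/
def LieAlgebroid.schoutenRight (D : Γ' ≃ₗ[R] Module.Dual R Γ) (A : LieAlgebroid R Γ)
    (W : Bivector R Γ') (u : Γ) : Bivector R Γ' :=
  -A.schouten D u W

/-- The coboundary operator `d_* : C^∞(M) → Γ(E)` of a Lie algebroid `E*`,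
`⟨d_* f, ξ⟩ = α_*(ξ)(f)`, with sections of `E = E**` seen as linear forms on `E*`. -/
def LieAlgebroid.dFun (B : LieAlgebroid R Γ') (f : R) : Module.Dual R Γ' where
  toFun ξ := B.anchor ξ f
  map_add' _ _ := by simp
  map_smul' _ _ := by simp

/-- The coboundary operator `d_* : Γ(E) → Γ(∧²E)` of a Lie algebroid `E*`,
`(d_* u)(ξ, η) = α_*(ξ)⟨u, η⟩ - α_*(η)⟨u, ξ⟩ - ⟨u, [ξ, η]⟩`. -/
def LieAlgebroid.dSec (D : Γ' ≃ₗ[R] Module.Dual R Γ) (B : LieAlgebroid R Γ') (u : Γ) :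
    Bivector R Γ' :=
  Bivector.ofForm (LinearMap.mk₂ R
    (fun ξ η => B.anchor ξ (D η u) - B.anchor η (D ξ u) - D (B.bracket ξ η) u)
    (fun _ _ _ => by simp only [map_add, LinearMap.add_apply, Derivation.add_apply]; ring)
    (fun f ξ η => by
      simp only [map_smul, LinearMap.smul_apply, Derivation.smul_apply, B.smul_bracket, map_sub,
        LinearMap.sub_apply, smul_eq_mul, Derivation.leibniz]; ring)
    (fun _ _ _ => by simp only [map_add, LinearMap.add_apply, Derivation.add_apply]; ring)
    (fun f ξ η => by
      simp only [map_smul, LinearMap.smul_apply, Derivation.smul_apply, B.leibniz, map_add,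
        LinearMap.add_apply, smul_eq_mul, Derivation.leibniz]; ring))
   (fun ξ => by simp [B.bracket_self])

/-- `(E, E*)` is a Lie bialgebroid: `d_*[u, v] = [d_* u, v] + [u, d_* v]`. -/
def IsLieBialgebroid (D : Γ' ≃ₗ[R] Module.Dual R Γ) (A : LieAlgebroid R Γ)
    (B : LieAlgebroid R Γ') : Prop :=
  ∀ u v, B.dSec D (A.bracket u v) =
    A.schoutenRight D (B.dSec D u) v + A.schouten D u (B.dSec D v)

/-- `d_* = [τ, ·]` on `Γ(E)` for some `τ ∈ Γ(∧²E)`. -/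
def IsInnerDifferential (D : Γ' ≃ₗ[R] Module.Dual R Γ) (A : LieAlgebroid R Γ)
    (B : LieAlgebroid R Γ') : Prop :=
  ∃ τ : Bivector R Γ', ∀ u, B.dSec D u = A.schoutenRight D τ u

/-- `(E, E*)` is a coboundary Lie bialgebroid: a Lie bialgebroid with `d_* = [τ, ·]` for some
`τ ∈ Γ(∧²E)`. -/
def IsCoboundaryLieBialgebroid (D : Γ' ≃ₗ[R] Module.Dual R Γ) (A : LieAlgebroid R Γ)
    (B : LieAlgebroid R Γ') : Prop :=
  IsLieBialgebroid D A B ∧ IsInnerDifferential D A B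

/-- The bundle map `φ : 𝔍E → ∧²E` is the lift of `d_*`:
`φ(𝕕u) = d_* u` and `φ(df ⊗ u) = d_* f ∧ u`. -/
def IsLift (D : Γ' ≃ₗ[R] Module.Dual R Γ) (B : LieAlgebroid R Γ')
    (φ : Jet R Γ →ₗ[R] Bivector R Γ') : Prop :=
  (∀ u, φ (Jet.prolong u) = B.dSec D u) ∧
    ∀ (f : R) (u : Γ),
      φ (Jet.dTensor f u) = Bivector.wedge (B.dFun f) (D.toLinearMap.flip u)

/-! #### Low degree cochains of the jet Lie algebroid with values in `∧²E` -/

/-- The tensor representation of the jet Lie algebroid `(𝔍E, [·,·]_π)` on `∧²E`, induced by the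
adjoint representation `π` on `E`. -/
def LieAlgebroid.tensorRep (D : Γ' ≃ₗ[R] Module.Dual R Γ) (A : LieAlgebroid R Γ) (μ : Jet R Γ)
    (W : Bivector R Γ') : Bivector R Γ' :=
  (A.adjoint μ).act D W

/-- The coboundary of a `0`-cochain: `(𝒟W)(μ) = μ · W`. -/
def LieAlgebroid.coboundary₀ (D : Γ' ≃ₗ[R] Module.Dual R Γ) (A : LieAlgebroid R Γ)
    (W : Bivector R Γ') (μ : Jet R Γ) : Bivector R Γ' :=
  A.tensorRep D μ W

/-- The coboundary of a `1`-cochain: `(𝒟φ)(μ, ν) = μ · φ(ν) - ν · φ(μ) - φ([μ, ν]_π)`. -/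
def LieAlgebroid.coboundary₁ (D : Γ' ≃ₗ[R] Module.Dual R Γ) (A : LieAlgebroid R Γ)
    (φ : Jet R Γ →ₗ[R] Bivector R Γ') (μ ν : Jet R Γ) : Bivector R Γ' :=
  A.tensorRep D μ (φ ν) - A.tensorRep D ν (φ μ) - φ (A.jetBracket μ ν)

/-- `φ` is a `1`-cocycle. -/
def IsOneCocycle (D : Γ' ≃ₗ[R] Module.Dual R Γ) (A : LieAlgebroid R Γ)
    (φ : Jet R Γ →ₗ[R] Bivector R Γ') : Prop :=
  ∀ μ ν, A.coboundary₁ D φ μ ν = 0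

/-- `φ` is a `1`-coboundary. -/
def IsOneCoboundary (D : Γ' ≃ₗ[R] Module.Dual R Γ) (A : LieAlgebroid R Γ)
    (φ : Jet R Γ →ₗ[R] Bivector R Γ') : Prop :=
  ∃ W : Bivector R Γ', ∀ μ, φ μ = A.coboundary₀ D W μ

end Calculus

end

set_option linter.unusedSectionVars false

noncomputable section

/-! ### Algebra over `R`, the stand-in for the smooth functions: jets, the lift and its cocycle
condition. -/

section Algebra

variable {R : Type*} [CommRing R] [Algebra ℝ R]
  {Γ : Type*} [AddCommGroup Γ] [Module ℝ Γ] [Module R Γ] [IsScalarTower ℝ R Γ]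
  {Γ' : Type*} [AddCommGroup Γ'] [Module ℝ Γ'] [Module R Γ'] [IsScalarTower ℝ R Γ']

/-! The core fact is that an `R`-linear map out of the jets is determined by its values on the
prolongations `𝕕u` (`Jet.form_eq_zero`). By the Leibniz rule, `df ⊗ u = 𝕕(fu) - f 𝕕u`; and locally
every jet is a combination of prolongations plus a jet with zero projection, which is a combination
of sections `df ⊗ u`. Uniqueness of the lift is immediate. Existence comes from an explicit formula
in the Lie derivatives of `E*` acting on `E = E**` (`LieAlgebroid.liftForm`), so it needs
reflexivity of the module of sections.

On `(𝕕u, 𝕕v)` the coboundary of the lift is the defect of the bialgebroid identity. This coboundary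
is skew and `R`-bilinear, so it vanishes once it vanishes on prolongations
(`IsLift.isLieBialgebroid_iff`). Similarly `φ(μ) = π(μ)W` may be tested on `μ = 𝕕u`, where it reads
`d_*u = [u, W] = [-W, u]` (`IsLift.isInnerDifferential_iff`). An inner `d_*` satisfies the
bialgebroid identity by Jacobi, which makes all conditions of the second part equivalent.

"Locally" means after multiplication by functions `χ` that together detect zero; no partition of
unity is needed. The geometric inputs are local frames (`exists_hasDualFrame`), local coordinates
for derivations via Hadamard's lemma (`exists_coordinates`) and reflexivity
(`dualSections_flip_bijective`). -/

/-- The identity of `N` multiplied by `χ` factors through a finite free module, as it does for a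
bump function `χ` supported where a vector bundle is trivial. -/
def HasDualFrame (N : Type*) [AddCommGroup N] [Module R N] (χ : R) : Prop :=
  ∃ (n : ℕ) (s : Fin n → N) (c : Fin n → Module.Dual R N), ∀ u, χ • u = ∑ i, c i u • s i

variable (R) in
/-- The analogue of `HasDualFrame` for derivations, with coefficients given by coordinate
functions. -/
def HasCoordinates (χ : R) : Prop :=
  ∃ (n : ℕ) (x : Fin n → R) (X : Fin n → Derivation ℝ R R),
    ∀ Y : Derivation ℝ R R, χ • Y = ∑ i, Y (x i) • X i

/-- An element of `R` that is annihilated by all `χ` with property `P` is zero. -/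
def IsSeparating (P : R → Prop) : Prop := ∀ r : R, (∀ χ, P χ → χ * r = 0) → r = 0

variable (R Γ) in
/-- The anchor of the gauge algebroid as a linear map. -/
def Gauge.symbolHom : Gauge R Γ →ₗ[R] Derivation ℝ R R where
  toFun := Gauge.symbol
  map_add' _ _ := rfl
  map_smul' _ _ := rfl

theorem Gauge.exists_ofEnd {δ : Gauge R Γ} (h : δ.symbol = 0) : ∃ Φ, δ = Gauge.ofEnd Φ :=
  ⟨{ toFun := δ.op
     map_add' := map_add _
     map_smul' := fun f u => by simp [Gauge.op_smul, h] },
    Gauge.ext (fun _ => rfl) (fun f => by simp [h])⟩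

/-- Vector fields lift to the gauge algebroid locally. -/
theorem HasDualFrame.exists_gauge {χ : R} (hχ : HasDualFrame Γ χ) (X : Derivation ℝ R R) :
    ∃ δ : Gauge R Γ, δ.symbol = χ • X := by
  obtain ⟨n, s, c, hc⟩ := hχ
  -- This is the flat connection of the frame. Its Leibniz defect is `X f • ∑ c i u • s i = X f • χ
  -- • u`, hence the symbol `χ • X`.
  refine ⟨⟨({ toFun := fun u => ∑ i, X (c i u) • s i
              map_add' := fun u v => by simp [add_smul, Finset.sum_add_distrib]
              map_smul' := fun r u => by
                have : ∀ i, c i (r • u) = r • c i u := fun i => by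
                  rw [← algebraMap_smul R r u, map_smul, algebraMap_smul]
                simp [this, Finset.smul_sum] }, χ • X), fun f u => ?_⟩, rfl⟩
  change ∑ i, X (c i (f • u)) • s i = f • ∑ i, X (c i u) • s i + (χ * X f) • u
  rw [mul_comm, mul_smul, hc, Finset.smul_sum, Finset.smul_sum, ← Finset.sum_add_distrib]
  refine Finset.sum_congr rfl fun i _ => ?_
  simp only [map_smul, smul_eq_mul, Derivation.leibniz]
  module

theorem Jet.dTensor_eq (f : R) (u : Γ) :
    Jet.dTensor f u = Jet.prolong (f • u) - f • Jet.prolong u := by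
  refine Jet.ext fun δ => ?_
  change δ.symbol f • u = δ.op (f • u) - f • δ.op u
  rw [δ.op_smul, add_sub_cancel_left]

/-- Jets that vanish on `gl(E)` are locally combinations of sections `df ⊗ u`. -/
theorem Jet.smul_mem_span_dTensor {χ χ' : R} (hχ : HasDualFrame Γ χ) (hχ' : HasCoordinates R χ')
    (ν : Jet R Γ) (hν : ν.proj = 0) :
    (χ * χ') • ν ∈ Submodule.span R (Set.range fun p : R × Γ => Jet.dTensor p.1 p.2) := by
  obtain ⟨n, x, X, hX⟩ := hχ'
  choose δ hδ using fun i => hχ.exists_gauge (X i)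
  have : (χ * χ') • ν = ∑ i, Jet.dTensor (x i) (ν.pair (δ i)) := by
    refine Jet.ext fun ε => ?_
    -- An operator with zero symbol lies in `gl(E)`, and there `ν` vanishes because its projection
    -- does.
    have hs : ((χ * χ') • ε - ∑ i, ε.symbol (x i) • δ i).symbol = 0 := by
      have h2 : (χ * χ') • ε.symbol - ∑ i, ε.symbol (x i) • (δ i).symbol = 0 := by
        rw [sub_eq_zero, mul_smul, hX, Finset.smul_sum]
        refine Finset.sum_congr rfl fun i _ => ?_
        rw [hδ, smul_comm]
      rw [← h2]
      exact (map_sub (Gauge.symbolHom R Γ) _ _).trans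
        (congrArg _ (map_sum (Gauge.symbolHom R Γ) _ _))
    obtain ⟨Φ, hΦ⟩ := Gauge.exists_ofEnd hs
    have h3 := congrArg ν.pair hΦ
    rw [Jet.pair_ofEnd, hν, map_zero, map_sub, map_sum, sub_eq_zero, map_smul] at h3
    rw [Jet.smul_pair, h3]
    change _ = (∑ i, Jet.dTensor (x i) (ν.pair (δ i))).1 ε
    rw [Submodule.coe_sum, LinearMap.sum_apply]
    exact Finset.sum_congr rfl fun i _ => map_smul _ _ _
  rw [this]
  exact Submodule.sum_mem _ fun i _ => Submodule.subset_span ⟨(x i, _), rfl⟩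

/-- A linear form on jets is determined by its values on prolongations of sections. -/
theorem Jet.form_eq_zero (hΓ : IsSeparating (R := R) (HasDualFrame Γ))
    (hR : IsSeparating (HasCoordinates R)) (θ : Jet R Γ →ₗ[R] R)
    (hθ : ∀ u, θ (Jet.prolong u) = 0) : θ = 0 := by
  have hd : ∀ ν ∈ Submodule.span R (Set.range fun p : R × Γ => Jet.dTensor p.1 p.2),
      θ ν = 0 := by
    intro ν hν
    refine Submodule.span_induction ?_ (map_zero θ) ?_ ?_ hν
    · rintro _ ⟨p, rfl⟩
      simp [Jet.dTensor_eq, hθ]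
    · intro a b _ _ ha hb; rw [map_add, ha, hb, add_zero]
    · intro r a _ ha; rw [map_smul, ha, smul_zero]
  refine LinearMap.ext fun μ => hΓ _ fun χ hχ => ?_
  obtain ⟨n, s, c, hc⟩ := id hχ
  -- Subtracting prolongations of the frame kills the projection, since `χ • μ.proj = ∑ c i μ.proj •
  -- s i`.
  let ν := χ • μ - ∑ i, c i μ.proj • Jet.prolong (s i)
  have hν : ν.proj = 0 := by
    change (χ • μ.1 - (∑ i, c i μ.proj • Jet.prolong (s i) : Jet R Γ).1)
      (Gauge.ofEnd LinearMap.id) = 0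
    rw [Submodule.coe_sum, LinearMap.sub_apply, LinearMap.sum_apply, sub_eq_zero]
    exact hc μ.proj
  have hθν : θ ν = χ * θ μ := by simp [ν, hθ]
  rw [← hθν]
  -- The span lemma costs one more factor of each kind.
  refine hR _ fun χ' hχ' => hΓ _ fun χ'' hχ'' => ?_
  rw [← mul_assoc, ← smul_eq_mul, ← map_smul]
  exact hd _ (Jet.smul_mem_span_dTensor hχ'' hχ' ν hν)

/-- Evaluation on a fixed pair of sections of `E*` reduces this to scalar forms. Uniqueness of the
lift and both equivalences rest on it. -/
theorem Jet.hom_bivector_ext (hΓ : IsSeparating (R := R) (HasDualFrame Γ))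
    (hR : IsSeparating (HasCoordinates R)) {φ ψ : Jet R Γ →ₗ[R] Bivector R Γ'}
    (h : ∀ u, φ (Jet.prolong u) = ψ (Jet.prolong u)) : φ = ψ := by
  refine LinearMap.ext fun μ => Bivector.ext_eval fun ξ η => ?_
  let θ : Jet R Γ →ₗ[R] R :=
    { toFun := fun μ => (φ μ).eval ξ η - (ψ μ).eval ξ η
      map_add' := fun μ ν => by
        simp only [map_add, Bivector.eval_apply, AlternatingMap.add_apply]; ring
      map_smul' := fun f μ => by
        simp only [map_smul, Bivector.eval_apply, AlternatingMap.smul_apply, smul_eq_mul,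
          RingHom.id_apply]; ring }
  have h0 := Jet.form_eq_zero hΓ hR θ fun u => by simp [θ, h]
  exact sub_eq_zero.1 (LinearMap.congr_fun h0 μ)

theorem Jet.hom_ext {D : Γ' ≃ₗ[R] Module.Dual R Γ}
    (hD : Function.Injective D.toLinearMap.flip) (hΓ : IsSeparating (R := R) (HasDualFrame Γ))
    (hR : IsSeparating (HasCoordinates R)) {φ ψ : Jet R Γ →ₗ[R] Γ}
    (h : ∀ u, φ (Jet.prolong u) = ψ (Jet.prolong u)) : φ = ψ := by
  refine LinearMap.ext fun μ => hD (LinearMap.ext fun ξ => ?_)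
  have h0 := Jet.form_eq_zero hΓ hR (D ξ ∘ₗ (φ - ψ)) fun u => by simp [h]
  have h1 := LinearMap.congr_fun h0 μ
  simp only [LinearMap.comp_apply, LinearMap.sub_apply, map_sub, LinearMap.zero_apply] at h1
  exact sub_eq_zero.1 h1

/-! #### Existence of the lift -/

section Lift

variable (D : Γ' ≃ₗ[R] Module.Dual R Γ)

/-- The dual of an operator on sections of `E`, as a section of the gauge algebroid of `E*`. -/
def Gauge.dualGauge (δ : Gauge R Γ) : Gauge R Γ' :=
  ⟨({ toFun := δ.dual D
      map_add' := δ.dual_add D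
      map_smul' := fun r ξ => by
        rw [← algebraMap_smul R r ξ, Gauge.dual_smul]; simp }, δ.symbol), δ.dual_smul D⟩

variable (hD : Function.Bijective D.toLinearMap.flip)

/-- Reflexivity `Γ(E) ≃ Hom(Γ(E*), C^∞(M))`. -/
def reflexiveEquiv : Γ ≃ₗ[R] Module.Dual R Γ' := LinearEquiv.ofBijective D.toLinearMap.flip hD

theorem reflexiveEquiv_apply (u : Γ) (ξ : Γ') : reflexiveEquiv D hD u ξ = D ξ u := rfl

/-- The Lie derivative of sections of `E = E**` along a section of the Lie algebroid `E*`. -/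
def LieAlgebroid.coad (B : LieAlgebroid R Γ') (ξ : Γ') : Gauge R Γ :=
  (B.ad ξ).dualGauge (reflexiveEquiv D hD)

theorem LieAlgebroid.coad_symbol (B : LieAlgebroid R Γ') (ξ : Γ') (f : R) :
    (B.coad D hD ξ).symbol f = B.anchor ξ f := rfl

theorem LieAlgebroid.coad_op (B : LieAlgebroid R Γ') (ξ η : Γ') (u : Γ) :
    D η ((B.coad D hD ξ).op u) = B.anchor ξ (D η u) - D (B.bracket ξ η) u :=
  Gauge.dual_pair (reflexiveEquiv D hD) (B.ad ξ) u η

theorem LieAlgebroid.coad_add (B : LieAlgebroid R Γ') (ξ η : Γ') :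
    B.coad D hD (ξ + η) = B.coad D hD ξ + B.coad D hD η := by
  refine Gauge.ext (fun u => hD.1 (LinearMap.ext fun ζ => ?_)) fun f => ?_
  · simp only [LinearMap.flip_apply, LinearEquiv.coe_coe, Gauge.op_add, map_add, B.coad_op,
      LinearMap.add_apply, Derivation.add_apply]
    ring
  · simp [B.coad_symbol]

/-- The endomorphism `u ↦ ⟨u, ξ⟩ d_* f`. -/
def LieAlgebroid.coadDefect (B : LieAlgebroid R Γ') (f : R) (ξ : Γ') : Γ →ₗ[R] Γ :=
  (D ξ).smulRight ((reflexiveEquiv D hD).symm (B.dFun f))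

theorem LieAlgebroid.pair_coadDefect (B : LieAlgebroid R Γ') (f : R) (ξ η : Γ') (u : Γ) :
    D η (B.coadDefect D hD f ξ u) = D ξ u * B.anchor η f := by
  simp only [coadDefect, LinearMap.smulRight_apply, map_smul, smul_eq_mul]
  rw [← reflexiveEquiv_apply D hD _ η, LinearEquiv.apply_symm_apply]
  rfl

/-- The Lie derivative fails to be `R`-linear in `ξ` only by an element of `gl(E)`, on which a jet
sees nothing but its projection. The lift can therefore compensate with a term in `μ.proj`. -/
theorem LieAlgebroid.coad_smul (B : LieAlgebroid R Γ') (f : R) (ξ : Γ') :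
    B.coad D hD (f • ξ) = f • B.coad D hD ξ + Gauge.ofEnd (B.coadDefect D hD f ξ) := by
  refine Gauge.ext (fun u => hD.1 (LinearMap.ext fun ζ => ?_)) fun g => ?_
  · change D ζ _ = D ζ _
    simp only [Gauge.op_add, map_add, B.coad_op, Gauge.smul_op, Gauge.ofEnd_op,
      B.pair_coadDefect, map_smul, Derivation.smul_apply,
      smul_eq_mul, B.smul_bracket, map_sub, LinearMap.sub_apply, LinearMap.smul_apply]
    ring
  · simp [B.coad_symbol]

/-- The bundle map `𝔍E → ∧²E` that lifts `d_*`. -/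
def LieAlgebroid.liftForm (B : LieAlgebroid R Γ') (μ : Jet R Γ) : Bivector R Γ' :=
  have skew : ∀ ξ η, D η (μ.pair (B.coad D hD ξ)) - D ξ (μ.pair (B.coad D hD η))
      + D (B.bracket ξ η) μ.proj = -(D ξ (μ.pair (B.coad D hD η)) -
        D η (μ.pair (B.coad D hD ξ)) + D (B.bracket η ξ) μ.proj) := fun ξ η => by
    rw [B.skew η ξ]; simp only [map_neg, LinearMap.neg_apply]; ring
  have add : ∀ ξ ξ' η, D η (μ.pair (B.coad D hD (ξ + ξ'))) - D (ξ + ξ') (μ.pair (B.coad D hD η))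
      + D (B.bracket (ξ + ξ') η) μ.proj = D η (μ.pair (B.coad D hD ξ)) -
        D ξ (μ.pair (B.coad D hD η)) + D (B.bracket ξ η) μ.proj +
        (D η (μ.pair (B.coad D hD ξ')) - D ξ' (μ.pair (B.coad D hD η)) +
          D (B.bracket ξ' η) μ.proj) := fun ξ ξ' η => by
    simp only [B.coad_add, map_add, LinearMap.add_apply]; ring
  -- The defect of `coad` contributes `⟨ξ, μ.proj⟩ α_*(η)f`, and the Leibniz rule in the bracket
  -- term contributes its negative.
  have smul : ∀ (f : R) ξ η, D η (μ.pair (B.coad D hD (f • ξ))) -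
      D (f • ξ) (μ.pair (B.coad D hD η)) + D (B.bracket (f • ξ) η) μ.proj =
        f • (D η (μ.pair (B.coad D hD ξ)) - D ξ (μ.pair (B.coad D hD η)) +
          D (B.bracket ξ η) μ.proj) := fun f ξ η => by
    simp only [B.coad_smul, map_add, map_smul, Jet.pair_ofEnd, B.pair_coadDefect,
      LinearMap.smul_apply, smul_eq_mul, B.smul_bracket, map_sub, LinearMap.sub_apply]; ring
  Bivector.ofForm (LinearMap.mk₂ R
    -- On `𝕕u` the two Lie derivatives produce `-⟨[ξ, η], u⟩` twice; the last term restores the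
    -- single copy in `d_*u`.
    (fun ξ η => D η (μ.pair (B.coad D hD ξ)) - D ξ (μ.pair (B.coad D hD η))
      + D (B.bracket ξ η) μ.proj)
    add smul
    (fun ξ η η' => by rw [skew, add, skew ξ η, skew ξ η']; ring)
    (fun f ξ η => by rw [skew, smul, skew ξ η, smul_neg]))
   (fun ξ => by simp [B.bracket_self])

theorem LieAlgebroid.liftForm_eval (B : LieAlgebroid R Γ') (μ : Jet R Γ) (ξ η : Γ') :
    (B.liftForm D hD μ).eval ξ η = D η (μ.pair (B.coad D hD ξ)) - D ξ (μ.pair (B.coad D hD η))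
      + D (B.bracket ξ η) μ.proj := rfl

theorem Jet.proj_add (μ ν : Jet R Γ) : (μ + ν).proj = μ.proj + ν.proj := rfl

theorem Jet.proj_smul (f : R) (μ : Jet R Γ) : (f • μ).proj = f • μ.proj := rfl

theorem Bivector.eval_add (V W : Bivector R Γ') (ξ η : Γ') :
    (V + W).eval ξ η = V.eval ξ η + W.eval ξ η := rfl

theorem Bivector.eval_sub (V W : Bivector R Γ') (ξ η : Γ') :
    (V - W).eval ξ η = V.eval ξ η - W.eval ξ η := rfl

theorem Bivector.eval_neg (W : Bivector R Γ') (ξ η : Γ') :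
    (-W).eval ξ η = -W.eval ξ η := rfl

theorem Bivector.eval_smul (f : R) (W : Bivector R Γ') (ξ η : Γ') :
    (f • W).eval ξ η = f * W.eval ξ η := rfl

theorem LieAlgebroid.exists_isLift
    (hD : Function.Bijective D.toLinearMap.flip) (B : LieAlgebroid R Γ') :
    ∃ φ : Jet R Γ →ₗ[R] Bivector R Γ', IsLift D B φ := by
  refine ⟨{ toFun := B.liftForm D hD, map_add' := fun μ ν => ?_, map_smul' := fun f μ => ?_ },
    fun u => ?_, fun f u => ?_⟩
  · refine Bivector.ext_eval fun ξ η => ?_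
    simp only [Bivector.eval_add, B.liftForm_eval, Jet.add_pair, Jet.proj_add, map_add]
    ring
  · refine Bivector.ext_eval fun ξ η => ?_
    simp only [RingHom.id_apply, Bivector.eval_smul, B.liftForm_eval, Jet.smul_pair,
      Jet.proj_smul, map_smul, smul_eq_mul]
    ring
  · refine Bivector.ext_eval fun ξ η => ?_
    change (B.liftForm D hD _).eval ξ η =
      B.anchor ξ (D η u) - B.anchor η (D ξ u) - D (B.bracket ξ η) u
    have hp : (Jet.prolong u : Jet R Γ).proj = u := rfl
    simp only [B.liftForm_eval, Jet.prolong_pair, B.coad_op, hp, B.skew η ξ, map_neg,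
      LinearMap.neg_apply]
    ring
  · refine Bivector.ext_eval fun ξ η => ?_
    change (B.liftForm D hD _).eval ξ η = B.anchor ξ f * D η u - B.anchor η f * D ξ u
    have hp : (Jet.dTensor f u : Jet R Γ).proj = 0 := by simp [Jet.proj]
    simp only [B.liftForm_eval, Jet.dTensor_pair, B.coad_symbol, hp, map_smul, smul_eq_mul,
      map_zero, add_zero]

end Lift

/-! #### The tensor representation -/

section TensorRep

variable (D : Γ' ≃ₗ[R] Module.Dual R Γ)

theorem Gauge.dual_smul_left (f : R) (δ : Gauge R Γ) (ξ : Γ') :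
    (f • δ).dual D ξ = f • δ.dual D ξ := by
  refine D.injective (LinearMap.ext fun u => ?_)
  simp only [Gauge.dual_pair, map_smul, LinearMap.smul_apply, smul_symbol, smul_op, smul_eq_mul]
  ring

theorem Gauge.dual_add_left (δ ε : Gauge R Γ) (ξ : Γ') :
    (δ + ε).dual D ξ = δ.dual D ξ + ε.dual D ξ := by
  refine D.injective (LinearMap.ext fun u => ?_)
  simp only [Gauge.dual_pair, map_add, LinearMap.add_apply, symbol_add, op_add]
  ring

theorem Gauge.dual_bracket (δ ε : Gauge R Γ) (ξ : Γ') :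
    (Gauge.bracket δ ε).dual D ξ = δ.dual D (ε.dual D ξ) - ε.dual D (δ.dual D ξ) := by
  refine D.injective (LinearMap.ext fun u => ?_)
  simp only [Gauge.dual_pair, map_sub, LinearMap.sub_apply, bracket_symbol, bracket_op]
  ring

theorem Gauge.act_smul_left (f : R) (δ : Gauge R Γ) (W : Bivector R Γ') :
    (f • δ).act D W = f • δ.act D W := by
  refine Bivector.ext_eval fun ξ η => ?_
  simp only [act_eval, Bivector.eval_smul, dual_smul_left, map_smul, LinearMap.smul_apply,
    smul_symbol, smul_eq_mul]
  ring

theorem Gauge.act_add_left (δ ε : Gauge R Γ) (W : Bivector R Γ') :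
    (δ + ε).act D W = δ.act D W + ε.act D W := by
  refine Bivector.ext_eval fun ξ η => ?_
  simp only [act_eval, Bivector.eval_add, dual_add_left, map_add, LinearMap.add_apply, symbol_add]
  ring

theorem Gauge.act_add (δ : Gauge R Γ) (V W : Bivector R Γ') :
    δ.act D (V + W) = δ.act D V + δ.act D W := by
  refine Bivector.ext_eval fun ξ η => ?_
  simp only [act_eval, Bivector.eval_add, map_add]
  ring

theorem Gauge.act_neg (δ : Gauge R Γ) (W : Bivector R Γ') :
    δ.act D (-W) = -δ.act D W := by
  refine Bivector.ext_eval fun ξ η => ?_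
  simp only [act_eval, Bivector.eval_neg, map_neg]
  ring

theorem Gauge.act_smul (f : R) (δ : Gauge R Γ) (W : Bivector R Γ') :
    δ.act D (f • W) = f • δ.act D W + δ.symbol f • W := by
  refine Bivector.ext_eval fun ξ η => ?_
  simp only [act_eval, Bivector.eval_add, Bivector.eval_smul, Derivation.leibniz, smul_eq_mul]
  ring

theorem Gauge.act_bracket (δ ε : Gauge R Γ) (W : Bivector R Γ') :
    (Gauge.bracket δ ε).act D W = δ.act D (ε.act D W) - ε.act D (δ.act D W) := by
  refine Bivector.ext_eval fun ξ η => ?_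
  simp only [act_eval, Bivector.eval_sub, dual_bracket, map_sub, LinearMap.sub_apply,
    bracket_symbol]
  ring

theorem LieAlgebroid.ad_bracket (A : LieAlgebroid R Γ) (u v : Γ) :
    A.ad (A.bracket u v) = Gauge.bracket (A.ad u) (A.ad v) := by
  refine Gauge.ext (fun w => ?_) fun f => ?_
  · rw [Gauge.bracket_op]
    simp only [ad_op, A.jacobi u v w, add_sub_cancel_right]
  · rw [Gauge.bracket_symbol]
    simp only [ad_symbol, A.anchor_bracket, Derivation.commutator_apply]

/-- By Jacobi, `ad [u, v]` acts on bivectors as the commutator of `ad u` and `ad v`; applied to `τ`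
this is the derivation property. -/
theorem IsInnerDifferential.isLieBialgebroid {D : Γ' ≃ₗ[R] Module.Dual R Γ}
    {A : LieAlgebroid R Γ} {B : LieAlgebroid R Γ'} (h : IsInnerDifferential D A B) :
    IsLieBialgebroid D A B := by
  obtain ⟨τ, hτ⟩ := h
  intro u v
  simp only [hτ, LieAlgebroid.schoutenRight, LieAlgebroid.schouten, A.ad_bracket,
    Gauge.act_bracket, Gauge.act_neg]
  abel

theorem IsLift.isInnerDifferential_iff {D : Γ' ≃ₗ[R] Module.Dual R Γ}
    (hΓ : IsSeparating (R := R) (HasDualFrame Γ)) (hR : IsSeparating (HasCoordinates R))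
    {A : LieAlgebroid R Γ} {B : LieAlgebroid R Γ'} {φ : Jet R Γ →ₗ[R] Bivector R Γ'}
    (hφ : IsLift D B φ) : IsInnerDifferential D A B ↔ IsOneCoboundary D A φ := by
  constructor
  · rintro ⟨τ, hτ⟩
    -- The sign comes from `[τ, u] = -[u, τ]`. As `π` and the action are `R`-linear, comparison on
    -- prolongations suffices.
    refine ⟨-τ, fun μ => ?_⟩
    let ψ : Jet R Γ →ₗ[R] Bivector R Γ' :=
      { toFun := fun μ => A.tensorRep D μ (-τ)
        map_add' := fun μ ν => by
          simp only [LieAlgebroid.tensorRep, map_add, Gauge.act_add_left]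
        map_smul' := fun f μ => by
          simp only [LieAlgebroid.tensorRep, map_smul, Gauge.act_smul_left, RingHom.id_apply] }
    have : φ = ψ := Jet.hom_bivector_ext hΓ hR fun u => by
      change _ = A.tensorRep D (Jet.prolong u) (-τ)
      rw [hφ.1, hτ, LieAlgebroid.tensorRep, A.adjoint_prolong, Gauge.act_neg]
      rfl
    exact LinearMap.congr_fun this μ
  · rintro ⟨W, hW⟩
    refine ⟨-W, fun u => ?_⟩
    rw [← hφ.1, hW, LieAlgebroid.coboundary₀, LieAlgebroid.tensorRep, A.adjoint_prolong,
      LieAlgebroid.schoutenRight, LieAlgebroid.schouten, Gauge.act_neg, neg_neg]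

end TensorRep

/-! #### The jet Lie algebroid -/

section JetAlgebroid

theorem Jet.sub_pair (μ ν : Jet R Γ) (δ : Gauge R Γ) :
    (μ - ν).pair δ = μ.pair δ - ν.pair δ := rfl

/-- Each of the two Lie derivative terms contributes `𝕕[u, v]`, and the last term of the bracket
removes one copy. -/
theorem LieAlgebroid.jetBracket_prolong (A : LieAlgebroid R Γ) (u v : Γ) :
    A.jetBracket (Jet.prolong u) (Jet.prolong v) = Jet.prolong (A.bracket u v) := by
  refine Jet.ext fun δ => ?_
  simp only [jetBracket, Jet.sub_pair, Jet.lieDeriv_pair, Jet.prolong_pair, A.adjoint_prolong,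
    Gauge.bracket_op, ad_op, A.skew v u, map_neg]
  abel

/-- The pairing of `𝔍E` with itself through `π` is skew-symmetric. -/
theorem LieAlgebroid.pair_adjoint_skew {D : Γ' ≃ₗ[R] Module.Dual R Γ}
    (hD : Function.Injective D.toLinearMap.flip) (hΓ : IsSeparating (R := R) (HasDualFrame Γ))
    (hR : IsSeparating (HasCoordinates R)) (A : LieAlgebroid R Γ) (μ ν : Jet R Γ) :
    ν.pair (A.adjoint μ) = -μ.pair (A.adjoint ν) := by
  let φ (ν : Jet R Γ) : Jet R Γ →ₗ[R] Γ := ν.pair ∘ₗ A.adjoint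
  let ψ (ν : Jet R Γ) : Jet R Γ →ₗ[R] Γ :=
    { toFun := fun μ => -μ.pair (A.adjoint ν)
      map_add' := fun μ μ' => by rw [Jet.add_pair]; abel
      map_smul' := fun f μ => by rw [Jet.smul_pair, smul_neg, RingHom.id_apply] }
  -- For `μ = 𝕕u` both sides equal `ν.pair (A.ad u)`, by the defining formula of `π(ν)`; linearity
  -- in `μ` does the rest.
  have h (u : Γ) (ν : Jet R Γ) : φ ν (Jet.prolong u) = ψ ν (Jet.prolong u) := by
    change ν.pair (A.adjoint (Jet.prolong u)) = -(Jet.prolong u).pair (A.adjoint ν)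
    rw [Jet.prolong_pair, A.adjoint_op, A.adjoint_prolong, neg_neg]
  exact LinearMap.congr_fun (Jet.hom_ext hD hΓ hR fun u => h u ν) μ

theorem Gauge.bracket_smul_left (f : R) (δ ε : Gauge R Γ) :
    Gauge.bracket (f • δ) ε = f • Gauge.bracket δ ε - ε.symbol f • δ := by
  rw [eq_sub_iff_add_eq]
  refine Gauge.ext (fun u => ?_) fun g => ?_
  · simp only [op_add, bracket_op, smul_op, op_smul, smul_sub]; abel
  · simp only [symbol_add, bracket_symbol, smul_symbol, Derivation.leibniz, smul_eq_mul]; ring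

theorem Gauge.bracket_add_left (δ δ' ε : Gauge R Γ) :
    Gauge.bracket (δ + δ') ε = Gauge.bracket δ ε + Gauge.bracket δ' ε := by
  refine Gauge.ext (fun u => ?_) fun g => ?_
  · simp only [op_add, bracket_op, map_add]; abel
  · simp only [symbol_add, bracket_symbol, map_add]; ring

theorem LieAlgebroid.jetBracket_add (A : LieAlgebroid R Γ) (μ ν ν' : Jet R Γ) :
    A.jetBracket μ (ν + ν') = A.jetBracket μ ν + A.jetBracket μ ν' := by
  refine Jet.ext fun δ => ?_
  simp only [jetBracket, Jet.sub_pair, Jet.lieDeriv_pair, Jet.prolong_pair, map_add,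
    Jet.add_pair, Gauge.bracket_add_left, Gauge.op_add]
  abel

theorem LieAlgebroid.jetBracket_skew {D : Γ' ≃ₗ[R] Module.Dual R Γ}
    (hD : Function.Injective D.toLinearMap.flip) (hΓ : IsSeparating (R := R) (HasDualFrame Γ))
    (hR : IsSeparating (HasCoordinates R)) (A : LieAlgebroid R Γ) (μ ν : Jet R Γ) :
    A.jetBracket ν μ = -A.jetBracket μ ν := by
  refine Jet.ext fun δ => ?_
  have : (-A.jetBracket μ ν).pair δ = -(A.jetBracket μ ν).pair δ := rfl
  rw [this]
  simp only [jetBracket, Jet.sub_pair, Jet.lieDeriv_pair, Jet.prolong_pair]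
  rw [A.pair_adjoint_skew hD hΓ hR μ ν, map_neg]
  abel

/-- On `δ`, the terms `L_{π(fν)} μ` and `𝕕⟨fν, π(μ)⟩` leave the extra terms `-δ(f)⟨μ, π(ν)⟩` and
`-δ(f)⟨ν, π(μ)⟩`. They cancel by skew-symmetry of the pairing. -/
theorem LieAlgebroid.jetBracket_smul {D : Γ' ≃ₗ[R] Module.Dual R Γ}
    (hD : Function.Injective D.toLinearMap.flip) (hΓ : IsSeparating (R := R) (HasDualFrame Γ))
    (hR : IsSeparating (HasCoordinates R)) (A : LieAlgebroid R Γ) (f : R) (μ ν : Jet R Γ) :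
    A.jetBracket μ (f • ν) = f • A.jetBracket μ ν + (A.adjoint μ).symbol f • ν := by
  refine Jet.ext fun δ => ?_
  simp only [jetBracket, Jet.sub_pair, Jet.lieDeriv_pair, Jet.prolong_pair, map_smul,
    Jet.smul_pair, Jet.add_pair, Gauge.bracket_smul_left, Gauge.op_smul, Gauge.smul_op, map_sub]
  rw [A.pair_adjoint_skew hD hΓ hR μ ν, map_neg]
  module

theorem IsLift.isLieBialgebroid_iff {D : Γ' ≃ₗ[R] Module.Dual R Γ}
    (hD : Function.Injective D.toLinearMap.flip) (hΓ : IsSeparating (R := R) (HasDualFrame Γ))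
    (hR : IsSeparating (HasCoordinates R))
    {A : LieAlgebroid R Γ} {B : LieAlgebroid R Γ'} {φ : Jet R Γ →ₗ[R] Bivector R Γ'}
    (hφ : IsLift D B φ) :
    IsLieBialgebroid D A B ↔ IsOneCocycle D A φ := by
  have key (u v : Γ) : A.coboundary₁ D φ (Jet.prolong u) (Jet.prolong v) = 0 ↔
      B.dSec D (A.bracket u v) = A.schoutenRight D (B.dSec D u) v + A.schouten D u (B.dSec D v) := by
    rw [LieAlgebroid.coboundary₁, LieAlgebroid.tensorRep, LieAlgebroid.tensorRep,
      A.jetBracket_prolong, hφ.1, hφ.1, hφ.1, A.adjoint_prolong, A.adjoint_prolong, sub_eq_zero,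
      eq_comm, LieAlgebroid.schoutenRight, LieAlgebroid.schouten, LieAlgebroid.schouten,
      neg_add_eq_sub]
  refine ⟨fun h => ?_, fun h u v => (key u v).1 (h _ _)⟩
  let c (μ : Jet R Γ) : Jet R Γ →ₗ[R] Bivector R Γ' :=
    { toFun := A.coboundary₁ D φ μ
      map_add' := fun ν ν' => by
        simp only [LieAlgebroid.coboundary₁, LieAlgebroid.tensorRep, map_add, Gauge.act_add,
          Gauge.act_add_left, A.jetBracket_add]
        abel
      -- The derivative of `f` from the action on `f • φ ν` cancels against the Leibniz term of the
      -- jet bracket.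
      map_smul' := fun f ν => by
        simp only [LieAlgebroid.coboundary₁, LieAlgebroid.tensorRep, map_smul, Gauge.act_smul,
          Gauge.act_smul_left, A.jetBracket_smul hD hΓ hR, map_add, RingHom.id_apply]
        module }
  have skew (μ ν) : c μ ν = -c ν μ := by
    change A.coboundary₁ D φ μ ν = -A.coboundary₁ D φ ν μ
    rw [LieAlgebroid.coboundary₁, LieAlgebroid.coboundary₁, A.jetBracket_skew hD hΓ hR μ ν,
      map_neg]
    abel
  -- Two passes of extension: first in the second argument with a prolongation in the first, then,
  -- through skew-symmetry, in the other.
  have h1 (u : Γ) : c (Jet.prolong u) = 0 :=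
    Jet.hom_bivector_ext hΓ hR fun v => (key u v).2 (h u v)
  intro μ ν
  have h2 : c μ = 0 := Jet.hom_bivector_ext hΓ hR fun u => by rw [skew, h1]; simp
  exact LinearMap.congr_fun h2 ν

end JetAlgebroid

end Algebra

/-! ### Hadamard's lemma on a finite-dimensional space -/

section Hadamard

open MeasureTheory intervalIntegral

/-- Interval integrals of smooth functions depend smoothly on parameters. -/
theorem contDiff_parametric_intervalIntegral_nat.{u} {V : Type u} [NormedAddCommGroup V]
    [NormedSpace ℝ V] [FiniteDimensional ℝ V] (n : ℕ) :
    ∀ {W : Type u} [NormedAddCommGroup W] [NormedSpace ℝ W] [CompleteSpace W]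
      {f : V → ℝ → W} (_ : ContDiff ℝ n f.uncurry) (a b : ℝ),
      ContDiff ℝ n fun y => ∫ t in a..b, f y t := by
  -- The target `W` varies in the induction because the derivative takes values in `V →L[ℝ] W`;
  -- sharing one universe keeps that space admissible.
  induction n with
  | zero =>
    intro W _ _ _ f hf a b
    exact contDiff_zero.2 (continuous_parametric_intervalIntegral_of_continuous' hf.continuous a b)
  | succ n ih =>
    intro W _ _ _ f hf a b
    let f' : V → ℝ → V →L[ℝ] W := fun y t =>
      (fderiv ℝ f.uncurry (y, t)).comp (ContinuousLinearMap.inl ℝ V ℝ)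
    have hf' : ContDiff ℝ n f'.uncurry :=
      (hf.fderiv_right (m := n) (by norm_cast)).clm_comp contDiff_const
    have hd : ∀ y t, HasFDerivAt (fun y => f y t) (f' y t) y := fun y t => by
      have h1 : HasFDerivAt f.uncurry (fderiv ℝ f.uncurry (y, t)) (y, t) :=
        (hf.differentiable (by simp) (y, t)).hasFDerivAt
      exact HasFDerivAt.comp (f := fun y => (y, t)) y h1 (hasFDerivAt_prodMk_left y t)
    have hy : ∀ y, Continuous (f y) := fun y =>
      hf.continuous.comp (Continuous.prodMk_right y)
    have hy' : ∀ y, Continuous (f' y) := fun y =>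
      hf'.continuous.comp (Continuous.prodMk_right y)
    have hproper : ProperSpace V := FiniteDimensional.proper ℝ V
    push_cast
    rw [contDiff_succ_iff_hasFDerivAt]
    refine ⟨fun y => ∫ t in a..b, f' y t, ih hf' a b, fun y => ?_⟩
    -- Compactness of ball times interval gives the constant dominating bound for differentiation
    -- under the integral.
    obtain ⟨C, hC⟩ := ((isCompact_closedBall y 1).prod
      (isCompact_uIcc (a := a) (b := b))).exists_bound_of_continuousOn hf'.continuous.continuousOn
    refine hasFDerivAt_integral_of_dominated_of_fderiv_le (bound := fun _ => C)
      (Metric.ball_mem_nhds y one_pos) (Filter.Eventually.of_forall fun z =>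
        (hy z).aestronglyMeasurable) ((hy y).intervalIntegrable a b) (hy' y).aestronglyMeasurable
      (Filter.Eventually.of_forall fun t ht z hz =>
        hC (z, t) ⟨Metric.ball_subset_closedBall hz, Set.uIoc_subset_uIcc ht⟩)
      intervalIntegrable_const (Filter.Eventually.of_forall fun t _ z _ => hd z t)

/-- Hadamard's lemma. -/
theorem ContDiff.exists_hadamard {V : Type*} [NormedAddCommGroup V] [NormedSpace ℝ V]
    [FiniteDimensional ℝ V] {f : V → ℝ} (hf : ContDiff ℝ ∞ f) (y₀ : V) :
    ∃ g : V → V →L[ℝ] ℝ, ContDiff ℝ ∞ g ∧ g y₀ = fderiv ℝ f y₀ ∧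
      ∀ y, f y - f y₀ = g y (y - y₀) := by
  have hf' : ContDiff ℝ ∞ (fderiv ℝ f) := hf.fderiv_right (by simp)
  have hc : ∀ y, Continuous fun t : ℝ => fderiv ℝ f (y₀ + t • (y - y₀)) := fun y =>
    hf'.continuous.comp (by fun_prop)
  -- The witness is the mean of the derivative along the segment from `y₀` to `y`.
  refine ⟨fun y => ∫ t in (0 : ℝ)..1, fderiv ℝ f (y₀ + t • (y - y₀)), ?_, by simp, fun y => ?_⟩
  · refine contDiff_infty.2 fun n => contDiff_parametric_intervalIntegral_nat n ?_ 0 1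
    have : ContDiff ℝ ∞ fun p : V × ℝ => fderiv ℝ f (y₀ + p.2 • (p.1 - y₀)) :=
      hf'.comp (by fun_prop)
    exact contDiff_infty.1 this n
  · have h1 : ∀ t ∈ Set.uIcc (0 : ℝ) 1, HasDerivAt (fun t : ℝ => f (y₀ + t • (y - y₀)))
        (fderiv ℝ f (y₀ + t • (y - y₀)) (y - y₀)) t := fun t _ => by
      have h2 : HasDerivAt (fun t : ℝ => y₀ + t • (y - y₀)) (y - y₀) t := by
        simpa using ((hasDerivAt_id t).smul_const (y - y₀)).const_add y₀
      exact ((hf.differentiable (by simp) _).hasFDerivAt).comp_hasDerivAt t h2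
    have h3 := integral_eq_sub_of_hasDerivAt h1
      (((hc y).clm_apply continuous_const).intervalIntegrable 0 1)
    rw [ContinuousLinearMap.intervalIntegral_apply ((hc y).intervalIntegrable 0 1), h3]
    simp

end Hadamard

/-! ### Derivations of the smooth functions in local coordinates -/

section VectorFields

variable {H : Type*} [NormedAddCommGroup H] [NormedSpace ℝ H] [FiniteDimensional ℝ H]
  {M : Type*} [TopologicalSpace M] [T2Space M] [ChartedSpace H M] [IsManifold 𝓘(ℝ, H) ∞ M]

variable (H) in
theorem exists_smooth_cutoff {m : M} {V : Set M} (hV : V ∈ nhds m) :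
    ∃ σ : C^∞⟮𝓘(ℝ, H), M; ℝ⟯, (∀ᶠ x in nhds m, σ x = 1) ∧ tsupport σ ⊆ V := by
  obtain ⟨ψ, -, hψ⟩ := (SmoothBumpFunction.nhds_basis_tsupport (I := 𝓘(ℝ, H)) m).mem_iff.1 hV
  exact ⟨⟨ψ, ψ.contMDiff⟩, ψ.eventuallyEq_one, hψ⟩

theorem ContMDiffOn.exists_cutoff_smul {G : Type*} [NormedAddCommGroup G] [NormedSpace ℝ G]
    {V : Set M} (hV : IsOpen V) {σ : C^∞⟮𝓘(ℝ, H), M; ℝ⟯}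
    (hσ : tsupport σ ⊆ V) {g : M → G} (hg : ContMDiffOn 𝓘(ℝ, H) 𝓘(ℝ, G) ∞ g V) :
    ContMDiff 𝓘(ℝ, H) 𝓘(ℝ, G) ∞ fun x => σ x • g x := by
  refine contMDiff_of_tsupport fun x hx => ?_
  have hx' : x ∈ V := hσ (tsupport_smul_subset_left _ _ hx)
  exact (σ.contMDiff x).smul (hg.contMDiffAt (hV.mem_nhds hx'))

theorem sum_contMDiffMap_apply {ι : Type*} (t : Finset ι) (g : ι → C^∞⟮𝓘(ℝ, H), M; ℝ⟯) (m : M) :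
    (∑ i ∈ t, g i) m = ∑ i ∈ t, g i m := map_sum (ContMDiffMap.evalRingHom m) g t

/-- The value of a derivation on a function with a first order expansion at `m`. -/
theorem Derivation.apply_eq_of_expansion
    (Y : Derivation ℝ C^∞⟮𝓘(ℝ, H), M; ℝ⟯ C^∞⟮𝓘(ℝ, H), M; ℝ⟯) {n : ℕ}
    (f : C^∞⟮𝓘(ℝ, H), M; ℝ⟯) (x : Fin n → C^∞⟮𝓘(ℝ, H), M; ℝ⟯) (g : Fin n → M → ℝ) {m : M}
    {V : Set M} (hV : IsOpen V) (hm : m ∈ V)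
    (hg : ∀ i, ContMDiffOn 𝓘(ℝ, H) 𝓘(ℝ) ∞ (g i) V)
    (h : ∀ z ∈ V, f z - f m = ∑ i, g i z * (x i z - x i m)) :
    Y f m = ∑ i, g i m * Y (x i) m := by
  obtain ⟨σ, hσ1, hσ⟩ := exists_smooth_cutoff H (hV.mem_nhds hm)
  let g' : Fin n → C^∞⟮𝓘(ℝ, H), M; ℝ⟯ := fun i => ⟨_, (hg i).exists_cutoff_smul hV hσ⟩
  -- The cutoff makes the expansion global. After applying `Y` and evaluating at `m`, every term
  -- where `Y` hits `σ` or `g' i` carries a factor vanishing at `m`.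
  have key : σ * (f - algebraMap ℝ _ (f m)) = ∑ i, g' i * (x i - algebraMap ℝ _ (x i m)) := by
    ext z
    rw [sum_contMDiffMap_apply]
    change σ z * (f z - f m) = ∑ i, σ z * g i z * (x i z - x i m)
    by_cases hz : z ∈ V
    · rw [h z hz, Finset.mul_sum]
      exact Finset.sum_congr rfl fun i _ => (mul_assoc _ _ _).symm
    · have : σ z = 0 := image_eq_zero_of_notMem_tsupport fun h => hz (hσ h)
      simp [this]
  have h2 := congrArg (fun r => Y r m) key
  simp only [map_sum, Derivation.leibniz, map_sub, Derivation.map_algebraMap, sub_zero,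
    smul_eq_mul] at h2
  rw [sum_contMDiffMap_apply] at h2
  change σ m * Y f m + (f m - f m) * Y σ m =
    ∑ i, (σ m * g i m * Y (x i) m + (x i m - x i m) * Y (g' i) m) at h2
  simpa [hσ1.self_of_nhds] using h2

-- In a chart, a first order expansion with smooth coefficients gives `Y f = ∑ Y(x i) ∂_i f`. Both
-- the coordinates and the partial derivatives must be cut off to become global objects.
variable (M) in
theorem exists_coordinates (m₀ : M) : ∃ χ : C^∞⟮𝓘(ℝ, H), M; ℝ⟯,
    χ m₀ = 1 ∧ HasCoordinates C^∞⟮𝓘(ℝ, H), M; ℝ⟯ χ := by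
  set e := extChartAt 𝓘(ℝ, H) m₀ with he
  let b := Module.finBasis ℝ H
  let b' : Fin (Module.finrank ℝ H) → H →L[ℝ] ℝ := fun i =>
    LinearMap.toContinuousLinearMap (b.coord i)
  have hs : e.source ∈ nhds m₀ := extChartAt_source_mem_nhds m₀
  have hso : IsOpen e.source := isOpen_extChartAt_source m₀
  have hto : IsOpen e.target := isOpen_extChartAt_target m₀
  have hes : ContMDiffOn 𝓘(ℝ, H) 𝓘(ℝ, H) ∞ e e.source := by
    rw [he, extChartAt_source]; exact contMDiffOn_extChartAt
  have hst : ContMDiffOn 𝓘(ℝ, H) 𝓘(ℝ, H) ∞ e.symm e.target := contMDiffOn_extChartAt_symm m₀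
  obtain ⟨ψ, hψ1, hψ⟩ := exists_smooth_cutoff H hs
  -- The support of `χ` lies where `ψ` is locally `1`, so wherever `χ` is nonzero the functions `ψ •
  -- b' i ∘ e` are genuine coordinates.
  obtain ⟨χ, hχ1, hχ⟩ := exists_smooth_cutoff H
    (Filter.inter_mem hs (interior_mem_nhds.2 hψ1))
  have hfe : ∀ f : C^∞⟮𝓘(ℝ, H), M; ℝ⟯, ContDiffOn ℝ ∞ (f ∘ e.symm) e.target := fun f =>
    contMDiffOn_iff_contDiffOn.1 (f.contMDiff.comp_contMDiffOn hst)
  have hχs : ∀ {z}, χ z ≠ 0 → z ∈ e.source ∩ interior {x | ψ x = 1} := fun {z} hz =>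
    hχ (subset_tsupport _ hz)
  have hdiff : ∀ (f : C^∞⟮𝓘(ℝ, H), M; ℝ⟯) {z}, z ∈ e.source →
      DifferentiableAt ℝ (f ∘ e.symm) (e z) := fun f z hz =>
    ((hfe f).contDiffAt (hto.mem_nhds (e.map_source hz))).differentiableAt (by simp)
  let x : Fin (Module.finrank ℝ H) → C^∞⟮𝓘(ℝ, H), M; ℝ⟯ := fun i =>
    ⟨fun z => ψ z • b' i (e z), ContMDiffOn.exists_cutoff_smul hso hψ
      ((b' i).contMDiff.comp_contMDiffOn hes)⟩
  let X' : Fin (Module.finrank ℝ H) → C^∞⟮𝓘(ℝ, H), M; ℝ⟯ → C^∞⟮𝓘(ℝ, H), M; ℝ⟯ := fun i f =>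
    ⟨fun z => χ z • fderiv ℝ (f ∘ e.symm) (e z) (b i), ContMDiffOn.exists_cutoff_smul hso
      (hχ.trans Set.inter_subset_left) (by
        have h1 : ContDiffOn ℝ ∞ (fun y => fderiv ℝ (f ∘ e.symm) y (b i)) e.target :=
          ((hfe f).fderiv_of_isOpen hto (by simp)).clm_apply contDiffOn_const
        exact h1.contMDiffOn.comp hes e.mapsTo)⟩
  let X : Fin (Module.finrank ℝ H) → Derivation ℝ C^∞⟮𝓘(ℝ, H), M; ℝ⟯ C^∞⟮𝓘(ℝ, H), M; ℝ⟯ :=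
    fun i => Derivation.mk'
      { toFun := X' i
        map_add' := fun f g => by
          ext z
          change χ z * fderiv ℝ (f ∘ e.symm + g ∘ e.symm) (e z) (b i) =
            χ z * fderiv ℝ (f ∘ e.symm) (e z) (b i) + χ z * fderiv ℝ (g ∘ e.symm) (e z) (b i)
          by_cases hz : χ z = 0
          · simp [hz]
          · rw [fderiv_add (hdiff f (hχs hz).1) (hdiff g (hχs hz).1)]
            exact mul_add _ _ _
        map_smul' := fun r f => by
          ext z
          change χ z * fderiv ℝ (r • (f ∘ e.symm)) (e z) (b i) =
            r * (χ z * fderiv ℝ (f ∘ e.symm) (e z) (b i))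
          by_cases hz : χ z = 0
          · simp [hz]
          · rw [fderiv_const_smul (hdiff f (hχs hz).1)]
            exact mul_left_comm _ _ _ }
      fun f g => by
        ext z
        change χ z * fderiv ℝ ((f ∘ e.symm) * (g ∘ e.symm)) (e z) (b i) =
          f z * (χ z * fderiv ℝ (g ∘ e.symm) (e z) (b i)) +
            g z * (χ z * fderiv ℝ (f ∘ e.symm) (e z) (b i))
        by_cases hz : χ z = 0
        · simp [hz]
        · rw [fderiv_mul (hdiff f (hχs hz).1) (hdiff g (hχs hz).1)]
          simp only [Function.comp_apply, e.left_inv (hχs hz).1, add_apply,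
            smul_apply, smul_eq_mul]
          ring
  refine ⟨χ, hχ1.self_of_nhds, _, x, X, fun Y => Derivation.ext fun f => ?_⟩
  ext m
  have hsum : (∑ i, Y (x i) • X i) f = ∑ i, Y (x i) * X i f := by
    have := map_sum (Derivation.coeFnAddMonoidHom (R := ℝ)) (fun i => Y (x i) • X i) Finset.univ
    exact (congrFun this f).trans (Finset.sum_apply _ _ _)
  rw [hsum, sum_contMDiffMap_apply]
  change χ m * Y f m = ∑ i, Y (x i) m * (χ m * fderiv ℝ (f ∘ e.symm) (e m) (b i))
  by_cases hm0 : χ m = 0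
  · simp [hm0]
  obtain ⟨hm, hmψ⟩ := hχs hm0
  -- Hadamard's lemma needs a function on all of `H`, so `f ∘ e.symm` is cut off inside the chart
  -- target without change near `e m`.
  obtain ⟨β, hβ1, hβ⟩ := exists_smooth_cutoff H (hto.mem_nhds (e.map_source hm))
  have hF : ContDiff ℝ ∞ fun y => β y • (f ∘ e.symm) y :=
    contMDiff_iff_contDiff.1 (ContMDiffOn.exists_cutoff_smul hto hβ (hfe f).contMDiffOn)
  obtain ⟨g, hg, hg0, hgF⟩ := hF.exists_hadamard (e m)
  have hFe : (fun y => β y • (f ∘ e.symm) y) =ᶠ[nhds (e m)] f ∘ e.symm := by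
    filter_upwards [hβ1] with y hy
    simp [hy]
  rw [hFe.fderiv_eq] at hg0
  have hcont : ContinuousAt e m := (hes.contMDiffAt (hso.mem_nhds hm)).continuousAt
  obtain ⟨V, hVsub, hVo, hmV⟩ := mem_nhds_iff.1 (Filter.inter_mem
    (Filter.inter_mem (hso.mem_nhds hm) (isOpen_interior.mem_nhds hmψ))
    (hcont.preimage_mem_nhds hβ1))
  have := Derivation.apply_eq_of_expansion Y f x (fun i z => g (e z) (b i)) hVo hmV
    (fun i => by
      have h1 : ContDiff ℝ ∞ fun y => g y (b i) := hg.clm_apply contDiff_const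
      exact (h1.contMDiff.comp_contMDiffOn hes).mono fun z hz => (hVsub hz).1.1)
    (fun z hz => by
      have hFz : ∀ w ∈ V, β (e w) • (f ∘ e.symm) (e w) = f w := fun w hw => by
        have hβw : β (e w) = 1 := (hVsub hw).2
        rw [hβw, one_smul, Function.comp_apply, e.left_inv (hVsub hw).1.1]
      have hxw : ∀ w ∈ V, ∀ i, x i w = b.repr (e w) i := fun w hw i => by
        have hψw : ψ w = 1 := interior_subset (s := {x | ψ x = 1}) (hVsub hw).1.2
        change ψ w • b.repr (e w) i = _
        rw [hψw, one_smul]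
      have h1 := hgF (e z)
      rw [hFz z hz, hFz m hmV] at h1
      rw [h1]
      conv_lhs => rw [← b.sum_repr (e z - e m)]
      rw [map_sum]
      refine Finset.sum_congr rfl fun i _ => ?_
      rw [hxw z hz, hxw m hmV, map_smul, map_sub, Finsupp.sub_apply, smul_eq_mul, mul_comm])
  rw [this, Finset.mul_sum]
  refine Finset.sum_congr rfl fun i _ => ?_
  rw [hg0]; ring

end VectorFields

/-! ### Local frames and reflexivity for smooth sections -/

section Bundles

variable {H : Type*} [NormedAddCommGroup H] [NormedSpace ℝ H] [FiniteDimensional ℝ H]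
  {M : Type*} [TopologicalSpace M] [T2Space M] [ChartedSpace H M] [IsManifold 𝓘(ℝ, H) ∞ M]
  {F : Type*} [NormedAddCommGroup F] [NormedSpace ℝ F] [FiniteDimensional ℝ F]
  {E : M → Type*} [TopologicalSpace (TotalSpace F E)]
  [∀ x, AddCommGroup (E x)] [∀ x, Module ℝ (E x)] [∀ x, TopologicalSpace (E x)]
  [FiberBundle F E] [VectorBundle ℝ F E] [ContMDiffVectorBundle ∞ F E 𝓘(ℝ, H)]

theorem sum_section_apply {ι : Type*} (t : Finset ι) (s : ι → Cₛ^∞⟮𝓘(ℝ, H); F, E⟯) (m : M) :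
    (∑ i ∈ t, s i) m = ∑ i ∈ t, s i m :=
  map_sum ((Pi.evalAddMonoidHom E m).comp (ContMDiffSection.coeAddHom 𝓘(ℝ, H) F ∞ E)) s t

-- Frame sections and coefficient functionals of a trivialization each carry a bump function `ψ`,
-- hence the factor `ψ * ψ`.
variable (F E) in
theorem exists_hasDualFrame (m₀ : M) : ∃ χ : C^∞⟮𝓘(ℝ, H), M; ℝ⟯,
    (∀ᶠ m in nhds m₀, χ m = 1) ∧ HasDualFrame Cₛ^∞⟮𝓘(ℝ, H); F, E⟯ χ := by
  set e := trivializationAt F E m₀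
  let b := Module.finBasis ℝ F
  have : ContMDiffVectorBundle 1 F E 𝓘(ℝ, H) := ContMDiffVectorBundle.of_le (n := ∞) (by simp)
  obtain ⟨ψ, hψ1, hψ⟩ := exists_smooth_cutoff H
    (e.open_baseSet.mem_nhds (FiberBundle.mem_baseSet_trivializationAt' m₀))
  let s : Fin (Module.finrank ℝ F) → Cₛ^∞⟮𝓘(ℝ, H); F, E⟯ := fun i =>
    ⟨(ψ : M → ℝ) • e.localFrame b i, ContMDiffOn.smul_section_of_tsupport
      ψ.contMDiff.contMDiffOn e.open_baseSet hψ (e.contMDiffOn_localFrame_baseSet ∞ b i)⟩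
  have hc : ∀ (u : Cₛ^∞⟮𝓘(ℝ, H); F, E⟯) i,
      ContMDiff 𝓘(ℝ, H) 𝓘(ℝ) ∞ (fun m => ψ m • e.localFrameCoeff 𝓘(ℝ, H) b i m (u m)) :=
    fun u i => ContMDiffOn.exists_cutoff_smul e.open_baseSet hψ
      (contMDiffOn_localFrameCoeff b e.open_baseSet subset_rfl u.contMDiff.contMDiffOn i)
  let c : Fin (Module.finrank ℝ F) →
      Module.Dual C^∞⟮𝓘(ℝ, H), M; ℝ⟯ Cₛ^∞⟮𝓘(ℝ, H); F, E⟯ := fun i =>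
    { toFun := fun u => ⟨_, hc u i⟩
      map_add' := fun u v => by
        ext m
        change ψ m * e.localFrameCoeff 𝓘(ℝ, H) b i m (u m + v m) =
          ψ m * e.localFrameCoeff 𝓘(ℝ, H) b i m (u m) +
            ψ m * e.localFrameCoeff 𝓘(ℝ, H) b i m (v m)
        rw [map_add, mul_add]
      map_smul' := fun f u => by
        ext m
        change ψ m * e.localFrameCoeff 𝓘(ℝ, H) b i m (f m • u m) =
          f m * (ψ m * e.localFrameCoeff 𝓘(ℝ, H) b i m (u m))
        rw [map_smul, smul_eq_mul, mul_left_comm] }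
  refine ⟨ψ * ψ, ?_, _, s, c, fun u => ?_⟩
  · filter_upwards [hψ1] with m hm
    change ψ m * ψ m = 1
    rw [hm, one_mul]
  · ext x
    rw [sum_section_apply]
    change (ψ x * ψ x) • u x = ∑ i, (ψ x • e.localFrameCoeff 𝓘(ℝ, H) b i x (u x)) •
      (ψ x • e.localFrame b i x)
    by_cases hx : x ∈ e.baseSet
    · conv_lhs => rw [e.eq_sum_localFrameCoeff_smul (I := 𝓘(ℝ, H)) (b := b) (s := u) hx]
      rw [Finset.smul_sum]
      refine Finset.sum_congr rfl fun i _ => ?_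
      simp only [smul_smul, smul_eq_mul]
      congr 1; ring
    · have h0 : ψ x = 0 := image_eq_zero_of_notMem_tsupport fun h => hx (hψ h)
      simp [h0]

theorem isSeparating_of_forall_exists {P : C^∞⟮𝓘(ℝ, H), M; ℝ⟯ → Prop}
    (h : ∀ m, ∃ χ, χ m = 1 ∧ P χ) : IsSeparating P := by
  intro r hr
  ext m
  obtain ⟨χ, hχ, hP⟩ := h m
  have h1 : χ m * r m = 0 := congrArg (fun f : C^∞⟮𝓘(ℝ, H), M; ℝ⟯ => f m) (hr χ hP)
  rwa [hχ, one_mul] at h1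

/-- The coefficient functionals of a local frame are themselves pairings with sections of `E*`. -/
theorem section_apply_eq_of_forall_pairing {u v : Cₛ^∞⟮𝓘(ℝ, H); F, E⟯} {m : M}
    (h : ∀ ξ, dualSections (E := E) ξ u m = dualSections ξ v m) : u m = v m := by
  obtain ⟨χ, hχ, n, s, c, hc⟩ := exists_hasDualFrame (H := H) F E m
  have key : ∀ w : Cₛ^∞⟮𝓘(ℝ, H); F, E⟯, w m = ∑ i, c i w m • s i m := fun w => by
    have h1 := congrArg (fun t : Cₛ^∞⟮𝓘(ℝ, H); F, E⟯ => t m) (hc w)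
    simp only [sum_section_apply] at h1
    change χ m • w m = _ at h1
    rw [hχ.self_of_nhds, one_smul] at h1
    exact h1
  rw [key u, key v]
  refine Finset.sum_congr rfl fun i _ => ?_
  have h2 := h (dualSections.symm (c i))
  rw [LinearEquiv.apply_symm_apply] at h2
  rw [h2]

theorem HasDualFrame.exists_flip_eq {R Γ Γ' : Type*} [CommRing R] [AddCommGroup Γ] [Module R Γ]
    [AddCommGroup Γ'] [Module R Γ'] (D : Γ' ≃ₗ[R] Module.Dual R Γ) {χ : R}
    (hχ : HasDualFrame Γ χ) (l : Module.Dual R Γ') :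
    ∃ u, D.toLinearMap.flip u = χ • l := by
  obtain ⟨n, s, c, hc⟩ := hχ
  refine ⟨∑ i, l (D.symm (c i)) • s i, LinearMap.ext fun ξ => ?_⟩
  -- The sections `D.symm (c i)` form the dual frame, in which `χ • ξ` has coefficients `D ξ (s i)`.
  have h1 : χ • ξ = ∑ i, D ξ (s i) • D.symm (c i) := by
    refine D.injective (LinearMap.ext fun u => ?_)
    rw [map_smul, LinearMap.smul_apply, ← map_smul, hc]
    simp [mul_comm]
  rw [LinearMap.smul_apply, ← map_smul, h1]
  simp [mul_comm]

/-- Smooth sections of a vector bundle form a reflexive module. -/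
theorem dualSections_flip_bijective : Function.Bijective
    (dualSections (H := H) (F := F) (E := E)).toLinearMap.flip := by
  constructor
  · intro u v h
    ext m
    exact section_apply_eq_of_forall_pairing fun ξ =>
      congrArg (fun f : C^∞⟮𝓘(ℝ, H), M; ℝ⟯ => f m) (LinearMap.congr_fun h ξ)
  · intro l
    choose χ hχ hframe using exists_hasDualFrame (H := H) F E
    choose u hu using fun m => (hframe m).exists_flip_eq dualSections l
    have hu' : ∀ m z ξ, dualSections ξ (u m) z = χ m z * l ξ z := fun m z ξ =>
      congrArg (fun f : C^∞⟮𝓘(ℝ, H), M; ℝ⟯ => f z) (LinearMap.congr_fun (hu m) ξ)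
    -- The section `u m` represents `χ m • l`, so near `m`, where `χ m = 1`, it agrees pointwise
    -- with the diagonal `z ↦ u z z`. This makes the diagonal smooth and a representative of `l`.
    have hloc : ∀ m, ∀ᶠ z in nhds m, u z z = u m z := fun m => by
      filter_upwards [hχ m] with z hz
      exact section_apply_eq_of_forall_pairing fun ξ => by
        rw [hu', hu', hz, (hχ z).self_of_nhds]
    refine ⟨⟨fun m => u m m, fun m => ?_⟩, LinearMap.ext fun ξ => ?_⟩
    · refine ((u m).contMDiff m).congr_of_eventuallyEq ?_
      filter_upwards [hloc m] with z hz
      rw [hz]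
    · ext m
      have h1 := hu' m m ξ
      rw [(hχ m).self_of_nhds, one_mul] at h1
      exact h1

end Bundles

end

/-! ### The theorem for smooth vector bundles -/

theorem proposition6p4
    {H : Type*} [NormedAddCommGroup H] [NormedSpace ℝ H] [FiniteDimensional ℝ H]
    {M : Type*} [TopologicalSpace M] [T2Space M] [SigmaCompactSpace M] [ChartedSpace H M]
    [IsManifold 𝓘(ℝ, H) ∞ M]
    {F : Type*} [NormedAddCommGroup F] [NormedSpace ℝ F] [FiniteDimensional ℝ F]
    {E : M → Type*} [TopologicalSpace (TotalSpace F E)]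
    [∀ x, AddCommGroup (E x)] [∀ x, Module ℝ (E x)] [∀ x, TopologicalSpace (E x)]
    [FiberBundle F E] [VectorBundle ℝ F E] [ContMDiffVectorBundle ∞ F E 𝓘(ℝ, H)]
    (A : LieAlgebroid C^∞⟮𝓘(ℝ, H), M; ℝ⟯ Cₛ^∞⟮𝓘(ℝ, H); F, E⟯)
    (B : LieAlgebroid C^∞⟮𝓘(ℝ, H), M; ℝ⟯
      Cₛ^∞⟮𝓘(ℝ, H); F →L[ℝ] ℝ, fun x : M => E x →L[ℝ] Trivial M ℝ x⟯) :
    (∃! dhat : Jet C^∞⟮𝓘(ℝ, H), M; ℝ⟯ Cₛ^∞⟮𝓘(ℝ, H); F, E⟯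
        →ₗ[C^∞⟮𝓘(ℝ, H), M; ℝ⟯] Bivector C^∞⟮𝓘(ℝ, H), M; ℝ⟯
          Cₛ^∞⟮𝓘(ℝ, H); F →L[ℝ] ℝ, fun x : M => E x →L[ℝ] Trivial M ℝ x⟯,
      IsLift dualSections B dhat) ∧
    ∀ dhat : Jet C^∞⟮𝓘(ℝ, H), M; ℝ⟯ Cₛ^∞⟮𝓘(ℝ, H); F, E⟯
        →ₗ[C^∞⟮𝓘(ℝ, H), M; ℝ⟯] Bivector C^∞⟮𝓘(ℝ, H), M; ℝ⟯
          Cₛ^∞⟮𝓘(ℝ, H); F →L[ℝ] ℝ, fun x : M => E x →L[ℝ] Trivial M ℝ x⟯,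
      IsLift dualSections B dhat →
        (IsLieBialgebroid dualSections A B ↔ IsOneCocycle dualSections A dhat) ∧
        (IsCoboundaryLieBialgebroid dualSections A B ↔ IsOneCoboundary dualSections A dhat) ∧
        (IsInnerDifferential dualSections A B ↔ IsOneCoboundary dualSections A dhat) := by
  have hΓ : IsSeparating (HasDualFrame Cₛ^∞⟮𝓘(ℝ, H); F, E⟯) :=
    isSeparating_of_forall_exists fun m =>
      let ⟨χ, h, h'⟩ := exists_hasDualFrame (H := H) F E m
      ⟨χ, h.self_of_nhds, h'⟩
  have hR : IsSeparating (HasCoordinates C^∞⟮𝓘(ℝ, H), M; ℝ⟯) :=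
    isSeparating_of_forall_exists (exists_coordinates M)
  have hD := dualSections_flip_bijective (H := H) (F := F) (E := E)
  constructor
  · obtain ⟨φ, hφ⟩ := B.exists_isLift dualSections hD
    exact ⟨φ, hφ, fun ψ hψ => Jet.hom_bivector_ext hΓ hR fun u => by rw [hψ.1, hφ.1]⟩
  · intro dhat hd
    have hinner := hd.isInnerDifferential_iff hΓ hR (A := A)
    exact ⟨hd.isLieBialgebroid_iff hD.1 hΓ hR,
      ⟨fun h => hinner.1 h.2, fun h => ⟨(hinner.2 h).isLieBialgebroid, hinner.2 h⟩⟩, hinner⟩
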